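/- Let $k\ge 2$ and let $\varphi_k:(\mathbb R^{2k-2},0)\to(\mathbb R^{2k-1},0)$ be the real minimal cross cap mapping of multiplicity $k$, \[ \varphi_k(u_1,\dots,u_{k-2},v_1,\dots,v_{k-1},y)=\Bigl(u_1,\dots,u_{k-2},v_1,\dots,v_{k-1},\;y^k+\sum_{i=1}^{k-2}u_iy^i,\;\sum_{i=1}^{k-1}v_iy^i\Bigr), \] with coordinates $U_1,\dots,U_{k-2},V_1,\dots,V_{k-1},W_1,W_2$ on the target. A vector field $\xi$ on the target is liftable over $\varphi_k$ if there is a smooth vector field $\eta$ on a neighbourhood of $0$ in $\mathbb R^{2k-2}$ with $d\varphi_k\circ\eta=\xi\circ\varphi_k$ there. Put $U_{k-1}=V_k=0$, $U_k=1$, and $U_r=V_r=0$ for $r\le 0$ and for $r>k$. Write a vector field on the target as a tuple $(A_1,\dots,A_{k-2},B_1,\dots,B_{k-1},C_1,C_2)$. Let \[ \xi_e:\quad A_i=(k-i)U_i,\qquad B_i=(k-i)V_i,\qquad C_1=kW_1,\qquad C_2=kW_2 , \] and for $1\le j\le k-1$ let $\xi^1_j,\xi^2_j,\xi^3_j$ be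 the polynomial vector fields with the following components. $\xi^1_j$: \begin{align*} A_i&=(k-i)(k-j)U_iU_j,\\ B_i&=k\sum_{r=1}^{i-1}U_{i+j-r}V_r-k\sum_{r=1}^{i}U_rV_{i+j-r}-(i-1)(k-j)U_jV_i+kV_{i+j}W_1-kU_{i+j}W_2,\\ C_1&=k(k-j)U_jW_1,\qquad C_2=-kV_jW_1+(k-j)U_jW_2. \end{align*} $\xi^2_j$: \begin{align*} A_i&=-k(k+i-j+1)U_{k+i-j+1}W_1+k\sum_{r=1}^{i}(k+i-j-2r+1)U_rU_{k+i-j-r+1}-j(i+1)U_{i+1}U_{k-j},\\ B_i&=-k(k+i-j+1)V_{k+i-j+1}W_1+k\sum_{r=1}^{i}(k+i-j-r+1)U_rV_{k+i-j-r+1}\\ &\qquad-k\sum_{r=1}^{i}rU_{k+i-j-r+1}V_r-j(i+1)U_{k-j}V_{i+1},\\ C_1&=k(k-j+1)U_{k-j+1}W_1+jU_1U_{k-j},\qquad C_2=k(k-j+1)V_{k-j+1}W_1+jV_1U_{k-j}. \end{align*} $\xi^3_j$: \begin{align*} A_i&=-k(k+i-j+1)U_{k+i-j+1}W_2+k\sum_{r=1}^{i}(k+i-j-r+1)U_{k+i-j-r+1}V_r\\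 &\qquad-k\sum_{r=1}^{i}rU_rV_{k+i-j-r+1}-k(i+1)U_{i+1}V_{k-j},\\ B_i&=-k(k+i-j+1)V_{k+i-j+1}W_2+k\sum_{r=1}^{i}(k+i-j-2r+1)V_rV_{k+i-j-r+1}-k(i+1)V_{i+1}V_{k-j},\\ C_1&=k(k-j+1)U_{k-j+1}W_2+kU_1V_{k-j},\qquad C_2=k(k-j+1)V_{k-j+1}W_2+kV_1V_{k-j}. \end{align*} Then the module, over the polynomial ring $\mathbb R[U_1,\dots,U_{k-2},V_1,\dots,V_{k-1},W_1,W_2]$, of the polynomial vector fields liftable over $\varphi_k$ is generated by $\xi_e$ and the vector fields $\xi^1_j,\xi^2_j,\xi^3_j$ for $1\le j\le k-1$. -/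

import Mathlib

open scoped ContDiff

noncomputable section

namespace CrossCap

/-- A vector field `ξ` on the target is liftable over the map germ `f` at the origin: there is a
smooth vector field `η` near the origin of the source with `df ∘ η = ξ ∘ f` there. -/
def LiftableOver {σ τ : Type*} [Fintype σ] [Fintype τ]
    (f : (σ → ℝ) → (τ → ℝ)) (ξ : (τ → ℝ) → (τ → ℝ)) : Prop :=
  ∃ s : Set (σ → ℝ), IsOpen s ∧ (0 : σ → ℝ) ∈ s ∧
    ∃ η : (σ → ℝ) → (σ → ℝ), ContDiffOn ℝ ∞ η s ∧
      ∀ x ∈ s, fderiv ℝ f x (η x) = ξ (f x)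

/-- Polynomial vector fields on `ℝ^τ`, written as tuples of components. -/
abbrev PolyField (τ : Type*) := τ → MvPolynomial τ ℝ

/-- The vector field (as a function) defined by a polynomial vector field. -/
def PolyField.toFun {τ : Type*} (ξ : PolyField τ) (X : τ → ℝ) : τ → ℝ :=
  fun t => MvPolynomial.eval X (ξ t)

theorem contDiff_eval {τ : Type*} [Fintype τ] (p : MvPolynomial τ ℝ) :
    ContDiff ℝ ∞ (fun X : τ → ℝ => MvPolynomial.eval X p) := by
  induction p using MvPolynomial.induction_on with
  | C a => simpa using contDiff_const
  | add p q hp hq => simpa using hp.add hq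
  | mul_X p i hp => simpa using hp.mul (contDiff_apply ℝ ℝ i)

/-- The module, over the polynomial ring of the target, of the polynomial vector fields that are
liftable over the smooth map `f`. -/
def liftablePolyFields {σ τ : Type*} [Fintype σ] [Fintype τ]
    (f : (σ → ℝ) → (τ → ℝ)) (hf : ContDiff ℝ ∞ f) :
    Submodule (MvPolynomial τ ℝ) (PolyField τ) where
  carrier := {ξ | LiftableOver f ξ.toFun}
  zero_mem' := ⟨Set.univ, isOpen_univ, Set.mem_univ _, 0, contDiffOn_const,
    fun x _ => by ext t; simp [PolyField.toFun]⟩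
  add_mem' := by
    rintro ξ ζ ⟨s, hs, h0s, η, hη, h⟩ ⟨s', hs', h0s', η', hη', h'⟩
    refine ⟨s ∩ s', hs.inter hs', ⟨h0s, h0s'⟩, η + η',
      (hη.mono Set.inter_subset_left).add (hη'.mono Set.inter_subset_right), ?_⟩
    intro x hx
    ext t
    simp [h x hx.1, h' x hx.2, PolyField.toFun]
  smul_mem' := by
    rintro p ξ ⟨s, hs, h0s, η, hη, h⟩
    refine ⟨s, hs, h0s, fun x => MvPolynomial.eval (f x) p • η x,
      (((contDiff_eval p).comp hf).contDiffOn).smul hη, ?_⟩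
    intro x hx
    ext t
    simp [h x hx, PolyField.toFun]

/-- Source coordinates `u_1, …, u_{k-2}`, `v_1, …, v_{k-1}`, `y`; the index `i` of `Fin` stands for
the subscript `i + 1`. -/
abbrev Src (k : ℕ) := Fin (k - 2) ⊕ Fin (k - 1) ⊕ Unit

/-- Target coordinates `U_1, …, U_{k-2}`, `V_1, …, V_{k-1}`, `W_1, W_2`; the index `i` of `Fin`
stands for the subscript `i + 1`. -/
abbrev Tgt (k : ℕ) := Fin (k - 2) ⊕ Fin (k - 1) ⊕ Fin 2

/-- The tuple with entries `A_1, …, A_{k-2}, B_1, …, B_{k-1}, C_1, C_2`. -/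
def tuple {α : Type*} (k : ℕ) (A B : ℤ → α) (C₁ C₂ : α) : Tgt k → α :=
  Sum.elim (fun i => A ((i : ℤ) + 1)) (Sum.elim (fun i => B ((i : ℤ) + 1)) ![C₁, C₂])

/-- The minimal cross cap mapping of multiplicity `k`,
`(u, v, y) ↦ (u, v, y^k + ∑ u_i y^i, ∑ v_i y^i)`. -/
def crossCap (k : ℕ) (x : Src k → ℝ) : Tgt k → ℝ :=
  let u : Fin (k - 2) → ℝ := fun i => x (Sum.inl i)
  let v : Fin (k - 1) → ℝ := fun i => x (Sum.inr (Sum.inl i))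
  let y : ℝ := x (Sum.inr (Sum.inr ()))
  Sum.elim u (Sum.elim v
    ![y ^ k + ∑ i, u i * y ^ ((i : ℕ) + 1), ∑ i, v i * y ^ ((i : ℕ) + 1)])

theorem contDiff_crossCap (k : ℕ) : ContDiff ℝ ∞ (crossCap k) := by
  refine contDiff_pi.2 ?_
  rintro (i | i | i)
  · exact contDiff_apply ℝ ℝ _
  · exact contDiff_apply ℝ ℝ _
  · fin_cases i <;> simp only [crossCap, Sum.elim_inr] <;> simp <;> fun_prop

/-- `U_r` for every integer `r`: the coordinate for `1 ≤ r ≤ k - 2`, with `U_k = 1` and `U_r = 0`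
for all other `r`. -/
def U (k : ℕ) (r : ℤ) : MvPolynomial (Tgt k) ℝ :=
  if h : 1 ≤ r ∧ r ≤ (k : ℤ) - 2 then
    MvPolynomial.X (Sum.inl ⟨(r - 1).toNat, by omega⟩)
  else if r = k then 1 else 0

/-- `V_r` for every integer `r`: the coordinate for `1 ≤ r ≤ k - 1`, and `V_r = 0` for all other
`r`. -/
def V (k : ℕ) (r : ℤ) : MvPolynomial (Tgt k) ℝ :=
  if h : 1 ≤ r ∧ r ≤ (k : ℤ) - 1 then
    MvPolynomial.X (Sum.inr (Sum.inl ⟨(r - 1).toNat, by omega⟩))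
  else 0

def W₁ (k : ℕ) : MvPolynomial (Tgt k) ℝ := MvPolynomial.X (Sum.inr (Sum.inr 0))

def W₂ (k : ℕ) : MvPolynomial (Tgt k) ℝ := MvPolynomial.X (Sum.inr (Sum.inr 1))

/-- The Euler vector field of `crossCap k`. -/
def eulerField (k : ℕ) : PolyField (Tgt k) :=
  tuple k
    (fun i => ((k - i : ℤ) : MvPolynomial (Tgt k) ℝ) * U k i)
    (fun i => ((k - i : ℤ) : MvPolynomial (Tgt k) ℝ) * V k i)
    ((k : MvPolynomial (Tgt k) ℝ) * W₁ k)
    ((k : MvPolynomial (Tgt k) ℝ) * W₂ k)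

/-- The first family `ξ^1_j`. -/
def xi₁ (k : ℕ) (j : ℤ) : PolyField (Tgt k) :=
  tuple k
    (fun i => (((k - i) * (k - j) : ℤ) : MvPolynomial (Tgt k) ℝ) * U k i * U k j)
    (fun i =>
      (k : MvPolynomial (Tgt k) ℝ) * (∑ r ∈ Finset.Icc 1 (i - 1), U k (i + j - r) * V k r)
        - (k : MvPolynomial (Tgt k) ℝ) * (∑ r ∈ Finset.Icc 1 i, U k r * V k (i + j - r))
        - (((i - 1) * (k - j) : ℤ) : MvPolynomial (Tgt k) ℝ) * U k j * V k i
        + (k : MvPolynomial (Tgt k) ℝ) * V k (i + j) * W₁ k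
        - (k : MvPolynomial (Tgt k) ℝ) * U k (i + j) * W₂ k)
    (((k * (k - j) : ℤ) : MvPolynomial (Tgt k) ℝ) * U k j * W₁ k)
    (-((k : MvPolynomial (Tgt k) ℝ) * V k j * W₁ k)
      + ((k - j : ℤ) : MvPolynomial (Tgt k) ℝ) * U k j * W₂ k)

/-- The second family `ξ^2_j`. -/
def xi₂ (k : ℕ) (j : ℤ) : PolyField (Tgt k) :=
  tuple k
    (fun i =>
      -(((k * (k + i - j + 1) : ℤ) : MvPolynomial (Tgt k) ℝ) * U k (k + i - j + 1) * W₁ k)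
        + (k : MvPolynomial (Tgt k) ℝ) * (∑ r ∈ Finset.Icc 1 i,
            ((k + i - j - 2 * r + 1 : ℤ) : MvPolynomial (Tgt k) ℝ)
              * U k r * U k (k + i - j - r + 1))
        - ((j * (i + 1) : ℤ) : MvPolynomial (Tgt k) ℝ) * U k (i + 1) * U k (k - j))
    (fun i =>
      -(((k * (k + i - j + 1) : ℤ) : MvPolynomial (Tgt k) ℝ) * V k (k + i - j + 1) * W₁ k)
        + (k : MvPolynomial (Tgt k) ℝ) * (∑ r ∈ Finset.Icc 1 i,
            ((k + i - j - r + 1 : ℤ) : MvPolynomial (Tgt k) ℝ)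
              * U k r * V k (k + i - j - r + 1))
        - (k : MvPolynomial (Tgt k) ℝ) * (∑ r ∈ Finset.Icc 1 i,
            (r : MvPolynomial (Tgt k) ℝ) * U k (k + i - j - r + 1) * V k r)
        - ((j * (i + 1) : ℤ) : MvPolynomial (Tgt k) ℝ) * U k (k - j) * V k (i + 1))
    (((k * (k - j + 1) : ℤ) : MvPolynomial (Tgt k) ℝ) * U k (k - j + 1) * W₁ k
      + (j : MvPolynomial (Tgt k) ℝ) * U k 1 * U k (k - j))
    (((k * (k - j + 1) : ℤ) : MvPolynomial (Tgt k) ℝ) * V k (k - j + 1) * W₁ k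
      + (j : MvPolynomial (Tgt k) ℝ) * V k 1 * U k (k - j))

/-- The third family `ξ^3_j`. -/
def xi₃ (k : ℕ) (j : ℤ) : PolyField (Tgt k) :=
  tuple k
    (fun i =>
      -(((k * (k + i - j + 1) : ℤ) : MvPolynomial (Tgt k) ℝ) * U k (k + i - j + 1) * W₂ k)
        + (k : MvPolynomial (Tgt k) ℝ) * (∑ r ∈ Finset.Icc 1 i,
            ((k + i - j - r + 1 : ℤ) : MvPolynomial (Tgt k) ℝ)
              * U k (k + i - j - r + 1) * V k r)
        - (k : MvPolynomial (Tgt k) ℝ) * (∑ r ∈ Finset.Icc 1 i,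
            (r : MvPolynomial (Tgt k) ℝ) * U k r * V k (k + i - j - r + 1))
        - ((k * (i + 1) : ℤ) : MvPolynomial (Tgt k) ℝ) * U k (i + 1) * V k (k - j))
    (fun i =>
      -(((k * (k + i - j + 1) : ℤ) : MvPolynomial (Tgt k) ℝ) * V k (k + i - j + 1) * W₂ k)
        + (k : MvPolynomial (Tgt k) ℝ) * (∑ r ∈ Finset.Icc 1 i,
            ((k + i - j - 2 * r + 1 : ℤ) : MvPolynomial (Tgt k) ℝ)
              * V k r * V k (k + i - j - r + 1))
        - ((k * (i + 1) : ℤ) : MvPolynomial (Tgt k) ℝ) * V k (i + 1) * V k (k - j))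
    (((k * (k - j + 1) : ℤ) : MvPolynomial (Tgt k) ℝ) * U k (k - j + 1) * W₂ k
      + (k : MvPolynomial (Tgt k) ℝ) * U k 1 * V k (k - j))
    (((k * (k - j + 1) : ℤ) : MvPolynomial (Tgt k) ℝ) * V k (k - j + 1) * W₂ k
      + (k : MvPolynomial (Tgt k) ℝ) * V k 1 * V k (k - j))

/-- The fields `ξ_e` and `ξ^1_j, ξ^2_j, ξ^3_j` for `1 ≤ j ≤ k - 1`. -/
def generators (k : ℕ) : Set (PolyField (Tgt k)) :=
  {eulerField k} ∪
    ⋃ j ∈ Set.Icc (1 : ℤ) ((k : ℤ) - 1), {xi₁ k j, xi₂ k j, xi₃ k j}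

end CrossCap

end

/-!
A field with components `(A, B, C)` lifts over the cross cap if and only if the polynomials
`C₁ - ∑ Aᵢ Xⁱ` and `C₂ - ∑ Bᵢ Xⁱ` become, on the graph `X = y`, the multiples by one and the same
polynomial `h` of the `y`-derivatives of the last two components of the cross cap. A smooth lift
only gives `h` as a smooth function, but it is a polynomial because the second derivative has the
form `v₁ + r` with `r` and the first derivative independent of `v₁`.

For the fields `ξ²ⱼ` and `ξ³ⱼ` the first polynomial is, up to terms free of `W₁` and `W₂`, the
product of `W₁` or `W₂` with a polynomial of degree `j - 1` with constant leading coefficient.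
Subtracting multiples of these fields therefore makes the first polynomial of a liftable field free
of `W₁` and `W₂`; being a multiple of the derivative of `Xᵏ + ∑ Uᵢ Xⁱ` and of smaller degree, it is
then zero, and so is `h`. In the same way `k ξₑ - ξ²₁` and the fields `ξ¹ⱼ - (k - j) Uⱼ ξₑ`, whose
first polynomials vanish, make the second polynomial free of `W₂`; it is then a multiple of
`W₁ - Xᵏ - ∑ Uᵢ Xⁱ` of degree less than `k`, hence zero.
-/

noncomputable section

namespace CrossCap

open Polynomial

/-! ### Division by powers of the variable -/

theorem sum_Icc_one_eq_add_sum_Icc_sub_one {M : Type*} [AddCommMonoid M] {b : ℤ} (hb : 1 ≤ b)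
    (f : ℤ → M) : ∑ r ∈ Finset.Icc 1 b, f r = f b + ∑ r ∈ Finset.Icc 1 (b - 1), f r := by
  rw [← Finset.insert_Icc_sub_one_right_eq_Icc hb, Finset.sum_insert (by simp)]

section Semiring

variable {R : Type*} [Semiring R]

theorem degree_lt_of_natDegree_le_of_coeff_eq_zero {p : R[X]} {n : ℕ}
    (hp : p.natDegree ≤ n) (hn : p.coeff n = 0) : p.degree < n :=
  (degree_lt_iff_coeff_zero p n).2 fun i hi => by
    obtain rfl | hlt := hi.eq_or_lt
    · exact hn
    · exact coeff_eq_zero_of_natDegree_lt (hp.trans_lt hlt)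

theorem coeff_X_mul_derivative (p : R[X]) (i : ℕ) :
    (X * derivative p).coeff i = i * p.coeff i := by
  rcases i with _ | i
  · simp
  · rw [coeff_X_mul, coeff_derivative, ← Nat.cast_succ, Nat.cast_comm]

theorem natDegree_X_mul_derivative_le (p : R[X]) : (X * derivative p).natDegree ≤ p.natDegree :=
  natDegree_le_iff_coeff_eq_zero.2 fun i hi => by
    rw [coeff_X_mul_derivative, coeff_eq_zero_of_natDegree_lt hi, mul_zero]

end Semiring

section Ring

variable {R : Type*} [Ring R]

theorem coeff_divByMonic_X_pow (p : R[X]) (n i : ℕ) : (p /ₘ X ^ n).coeff i = p.coeff (n + i) := by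
  nontriviality R
  have hlt : (p %ₘ X ^ n).degree < (n + i : ℕ) :=
    (degree_modByMonic_lt p (monic_X_pow n)).trans_le
      ((degree_X_pow n).trans_le (Nat.cast_le.2 (Nat.le_add_right n i)))
  conv_rhs => rw [← modByMonic_add_div p (X ^ n), coeff_add, coeff_eq_zero_of_degree_lt hlt,
    zero_add, add_comm n i, coeff_X_pow_mul]

theorem coeff_modByMonic_X_pow (p : R[X]) {n i : ℕ} (hi : i < n) :
    (p %ₘ X ^ n).coeff i = p.coeff i := by
  conv_rhs => rw [← modByMonic_add_div p (X ^ n), coeff_add, coeff_X_pow_mul', if_neg (by omega),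
    add_zero]

theorem natDegree_divByMonic_X_pow_le {p : R[X]} {m n : ℕ} (hp : p.natDegree ≤ n + m) :
    (p /ₘ X ^ n).natDegree ≤ m :=
  natDegree_le_iff_coeff_eq_zero.2 fun i hi => by
    rw [coeff_divByMonic_X_pow, coeff_eq_zero_of_natDegree_lt (by omega)]

theorem natDegree_modByMonic_X_pow_succ_le (p : R[X]) (n : ℕ) :
    (p %ₘ X ^ (n + 1)).natDegree ≤ n := by
  nontriviality R
  exact Nat.lt_succ_iff.1 <| (natDegree_modByMonic_lt p (monic_X_pow _) fun h => by
    simpa using congrArg natDegree h).trans_eq (natDegree_X_pow _)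

end Ring

section CommRing

variable {R : Type*} [CommRing R]

/-- The Bezoutian-type combination `q ⌊p / Xⁿ⌋ - p ⌊q / Xⁿ⌋`, in which the terms of high degree
cancel. -/
def truncBezout (n : ℕ) (p q : R[X]) : R[X] := q * (p /ₘ X ^ n) - p * (q /ₘ X ^ n)

theorem truncBezout_eq_modByMonic (n : ℕ) (p q : R[X]) :
    truncBezout n p q = (q %ₘ X ^ n) * (p /ₘ X ^ n) - (p %ₘ X ^ n) * (q /ₘ X ^ n) := by
  have hp := modByMonic_add_div p (X ^ n)
  have hq := modByMonic_add_div q (X ^ n)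
  unfold truncBezout
  linear_combination (q /ₘ X ^ n) * hp - (p /ₘ X ^ n) * hq

theorem natDegree_truncBezout_le {p q : R[X]} {n d : ℕ} (hn : n < d) (hp : p.natDegree ≤ d)
    (hq : q.natDegree ≤ d) : (truncBezout (n + 1) p q).natDegree ≤ d - 1 := by
  obtain ⟨m, rfl⟩ := Nat.exists_eq_add_of_le (Nat.succ_le_of_lt hn)
  rw [truncBezout_eq_modByMonic, show n.succ + m - 1 = n + m by omega]
  refine (natDegree_sub_le_of_le ?_ ?_).trans_eq (max_self _)
  · exact natDegree_mul_le_of_le (natDegree_modByMonic_X_pow_succ_le q n)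
      (natDegree_divByMonic_X_pow_le hp)
  · exact natDegree_mul_le_of_le (natDegree_modByMonic_X_pow_succ_le p n)
      (natDegree_divByMonic_X_pow_le hq)

theorem coeff_truncBezout_top {p q : R[X]} {n d : ℕ} (hn : n < d) (hp : p.natDegree ≤ d)
    (hq : q.natDegree ≤ d) : (truncBezout (n + 1) p q).coeff (d - 1) =
      q.coeff n * p.coeff d - p.coeff n * q.coeff d := by
  obtain ⟨m, rfl⟩ := Nat.exists_eq_add_of_le (Nat.succ_le_of_lt hn)
  rw [truncBezout_eq_modByMonic, coeff_sub, show n.succ + m - 1 = n + m by omega,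
    coeff_mul_add_eq_of_natDegree_le (natDegree_modByMonic_X_pow_succ_le q n)
      (natDegree_divByMonic_X_pow_le hp),
    coeff_mul_add_eq_of_natDegree_le (natDegree_modByMonic_X_pow_succ_le p n)
      (natDegree_divByMonic_X_pow_le hq)]
  simp only [coeff_divByMonic_X_pow, coeff_modByMonic_X_pow _ n.lt_succ_self, Nat.succ_eq_add_one]

theorem coeff_mul_divByMonic_X_pow {p q : R[X]} {a b : ℤ → R}
    (hp : ∀ i : ℕ, p.coeff i = a i) (hq : ∀ i : ℕ, q.coeff i = b i) (hb : b 0 = 0) (n i : ℕ) :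
    (q * (p /ₘ X ^ n)).coeff i = ∑ r ∈ Finset.Icc (1 : ℤ) i, b r * a (n + i - r) := by
  rw [coeff_mul, Finset.Nat.sum_antidiagonal_eq_sum_range_succ
    (fun r s => q.coeff r * (p /ₘ X ^ n).coeff s), Finset.sum_range_succ']
  simp only [hq, Nat.cast_zero, hb, zero_mul, add_zero]
  refine Finset.sum_bij (fun r _ => (r + 1 : ℤ)) ?_ (by simp) ?_ ?_
  · intro r hr
    simp only [Finset.mem_range] at hr
    simp only [Finset.mem_Icc]
    omega
  · intro r hr
    rw [Finset.mem_Icc] at hr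
    exact ⟨(r - 1).toNat, by rw [Finset.mem_range]; omega, by omega⟩
  · intro r hr
    rw [Finset.mem_range] at hr
    rw [coeff_divByMonic_X_pow, hp]
    push_cast [Nat.cast_sub (Nat.succ_le_of_lt hr)]
    ring_nf

/-- Modulo `w - q`, this polynomial is `(κ X ⌊q / Xⁿ⌋ + c) p'`; the multiple of `w - q` that has
been added makes its degree smaller than those of `p` and `q`. -/
def reducedMultiple (n : ℕ) (κ w c : R) (q p : R[X]) : R[X] :=
  C κ * (C w * (X * derivative p /ₘ X ^ n) - truncBezout n (X * derivative p) q) +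
    C c * derivative p

theorem reducedMultiple_eq (n : ℕ) (κ w c : R) (q p : R[X]) :
    reducedMultiple n κ w c q p =
      C κ * (X * derivative p /ₘ X ^ n) * (C w - q) +
        (C κ * X * (q /ₘ X ^ n) + C c) * derivative p := by
  unfold reducedMultiple truncBezout
  ring

theorem coeff_reducedMultiple {p q : R[X]} {a b : ℤ → R} (hp : ∀ i : ℕ, p.coeff i = a i)
    (hq : ∀ i : ℕ, q.coeff i = b i) (hb : b 0 = 0) (n : ℕ) (κ w c : R) (i : ℕ) :
    (reducedMultiple n κ w c q p).coeff i =
      κ * ((n + i : ℤ) * a (n + i) * w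
        - ∑ r ∈ Finset.Icc (1 : ℤ) i, b r * ((n + i - r : ℤ) * a (n + i - r))
        + ∑ r ∈ Finset.Icc (1 : ℤ) i, r * a r * b (n + i - r)) + c * ((i + 1) * a (i + 1)) := by
  have hθ : ∀ i : ℕ, (X * derivative p).coeff i = ((i : ℤ) : R) * a i := fun i => by
    rw [coeff_X_mul_derivative, hp, Int.cast_natCast]
  rw [reducedMultiple, coeff_add, coeff_C_mul, coeff_C_mul, coeff_sub, coeff_C_mul,
    truncBezout, coeff_sub, coeff_mul_divByMonic_X_pow (a := fun i => (i : R) * a i) hθ hq hb,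
    coeff_mul_divByMonic_X_pow (b := fun i => (i : R) * a i) hq hθ (by simp),
    coeff_divByMonic_X_pow, hθ, coeff_derivative, hp]
  push_cast
  ring

theorem coeff_zero_reducedMultiple {p q : R[X]} (hq : q.coeff 0 = 0) (n : ℕ) (κ w c : R) :
    (reducedMultiple n κ w c q p).coeff 0 = κ * (n * p.coeff n * w) + c * p.coeff 1 := by
  simp only [reducedMultiple, truncBezout, coeff_add, coeff_sub, coeff_C_zero, mul_coeff_zero, hq,
    coeff_X_zero, zero_mul, sub_zero, coeff_divByMonic_X_pow, add_zero, coeff_X_mul_derivative,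
    coeff_derivative, Nat.cast_zero, zero_add, mul_one]
  ring

theorem natDegree_reducedMultiple_le {p q : R[X]} {n d : ℕ} (hn : n < d) (hp : p.natDegree ≤ d)
    (hq : q.natDegree ≤ d) (κ w c : R) :
    (reducedMultiple (n + 1) κ w c q p).natDegree ≤ d - 1 := by
  have hθ := (natDegree_X_mul_derivative_le p).trans hp
  refine natDegree_add_le_of_degree_le ?_ ?_
  · refine (natDegree_C_mul_le _ _).trans
      ((natDegree_sub_le_of_le ?_ (natDegree_truncBezout_le hn hθ hq)).trans_eq (max_self _))
    exact (natDegree_C_mul_le _ _).trans (natDegree_divByMonic_X_pow_le (by omega))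
  · exact (natDegree_C_mul_le _ _).trans ((natDegree_derivative_le p).trans (by omega))

theorem coeff_reducedMultiple_top {p q : R[X]} {n d : ℕ} (hn₀ : n ≠ 0) (hn : n < d)
    (hp : p.natDegree ≤ d) (hq : q.natDegree ≤ d) (κ w c : R) :
    (reducedMultiple (n + 1) κ w c q p).coeff (d - 1) =
      κ * (n * p.coeff n * q.coeff d) + (c - κ * q.coeff n) * (d * p.coeff d) := by
  have hθ := (natDegree_X_mul_derivative_le p).trans hp
  have hvanish : (X * derivative p).coeff (n + 1 + (d - 1)) = 0 :=
    coeff_eq_zero_of_natDegree_lt (by omega)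
  have hd : ((d - 1 : ℕ) : R) + 1 = d := by
    rw [← Nat.cast_succ, Nat.succ_eq_add_one, Nat.sub_add_cancel (by omega)]
  rw [reducedMultiple, coeff_add, coeff_C_mul, coeff_C_mul, coeff_sub, coeff_C_mul,
    coeff_divByMonic_X_pow, hvanish, coeff_truncBezout_top hn hθ hq, coeff_derivative,
    coeff_X_mul_derivative, coeff_X_mul_derivative, Nat.sub_add_cancel (by omega), hd]
  ring

theorem sum_sub_two_mul (s : Finset ℤ) (n : ℤ) (a : ℤ → R) :
    ∑ r ∈ s, ((n - 2 * r : ℤ) : R) * a r * a (n - r) =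
      ∑ r ∈ s, a r * ((n - r : ℤ) * a (n - r)) - ∑ r ∈ s, r * a r * a (n - r) := by
  rw [← Finset.sum_sub_distrib]
  refine Finset.sum_congr rfl fun r _ => ?_
  push_cast
  ring

end CommRing

/-! ### Reduction of the coefficients -/

section Supported

variable {σ 𝕜 B : Type*} [CommRing 𝕜] [CommRing B] [Algebra 𝕜 B]

theorem dvd_map_sub_map_of_supported {f g : MvPolynomial σ 𝕜 →ₐ[𝕜] B} {d : B} {s : Set σ}
    (h : ∀ t ∈ s, d ∣ f (MvPolynomial.X t) - g (MvPolynomial.X t)) {p : MvPolynomial σ 𝕜}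
    (hp : p ∈ MvPolynomial.supported 𝕜 s) : d ∣ f p - g p := by
  simp only [← Ideal.mem_span_singleton, ← Ideal.Quotient.eq] at h ⊢
  have heq : Set.EqOn ((Ideal.Quotient.mkₐ 𝕜 (Ideal.span {d})).comp f)
      ((Ideal.Quotient.mkₐ 𝕜 (Ideal.span {d})).comp g)
      (MvPolynomial.supported 𝕜 s) := by
    rw [MvPolynomial.supported_eq_adjoin_X, AlgHom.eqOn_adjoin_iff]
    rintro _ ⟨t, ht, rfl⟩
    exact h t ht
  exact heq hp

theorem map_eq_map_of_supported {f g : MvPolynomial σ 𝕜 →ₐ[𝕜] B} {s : Set σ}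
    (h : ∀ t ∈ s, f (MvPolynomial.X t) = g (MvPolynomial.X t)) {p : MvPolynomial σ 𝕜}
    (hp : p ∈ MvPolynomial.supported 𝕜 s) : f p = g p :=
  sub_eq_zero.1 <| zero_dvd_iff.1 <|
    dvd_map_sub_map_of_supported (fun t ht => zero_dvd_iff.2 (sub_eq_zero.2 (h t ht))) hp

theorem exists_common_factor_of_mul_X_add_eq_mul [IsDomain 𝕜] {t : σ} {r p a b : MvPolynomial σ 𝕜}
    (hr : r ∈ MvPolynomial.supported 𝕜 {t}ᶜ) (hp : p ∈ MvPolynomial.supported 𝕜 {t}ᶜ)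
    (hp₀ : p ≠ 0) (h : a * (MvPolynomial.X t + r) = b * p) :
    ∃ g, a = g * p ∧ b = g * (MvPolynomial.X t + r) := by
  classical
  let φ : MvPolynomial σ 𝕜 →ₐ[𝕜] MvPolynomial σ 𝕜 :=
    MvPolynomial.aeval (Function.update MvPolynomial.X t (-r))
  have hφt : φ (MvPolynomial.X t) = -r := by
    rw [MvPolynomial.aeval_X, Function.update_self]
  have hφ {q : MvPolynomial σ 𝕜} (hq : q ∈ MvPolynomial.supported 𝕜 {t}ᶜ) : φ q = q :=
    map_eq_map_of_supported (g := AlgHom.id 𝕜 _) (fun s hs => by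
      rw [MvPolynomial.aeval_X, Function.update_of_ne hs, AlgHom.id_apply]) hq
  have hdvd (q : MvPolynomial σ 𝕜) : MvPolynomial.X t + r ∣ q - φ q := by
    refine dvd_map_sub_map_of_supported (f := AlgHom.id 𝕜 _) (s := Set.univ) (fun s _ => ?_)
      (MvPolynomial.supported_univ (R := 𝕜) (σ := σ) ▸ Algebra.mem_top)
    obtain rfl | hs := eq_or_ne s t
    · rw [hφt, AlgHom.id_apply, sub_neg_eq_add]
    · rw [MvPolynomial.aeval_X, Function.update_of_ne hs, AlgHom.id_apply, sub_self]
      exact dvd_zero _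
  have hb : φ b = 0 := by
    have := congrArg φ h
    rw [map_mul, map_mul, map_add, hφt, hφ hr, hφ hp, neg_add_cancel, mul_zero] at this
    exact (mul_eq_zero.1 this.symm).resolve_right hp₀
  have hne : MvPolynomial.X t + r ≠ 0 := fun h₀ => by
    have hX : MvPolynomial.X t ∈ MvPolynomial.supported 𝕜 {t}ᶜ :=
      eq_neg_of_add_eq_zero_left h₀ ▸ neg_mem hr
    exact MvPolynomial.X_mem_supported.1 hX rfl
  obtain ⟨g, hg⟩ := hdvd b
  rw [hb, sub_zero] at hg
  refine ⟨g, mul_right_cancel₀ hne ?_, by rw [hg, mul_comm]⟩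
  rw [h, hg]
  ring

end Supported

section Coefficients

variable {𝕜 S : Type*} [CommRing 𝕜] [CommRing S] [Algebra 𝕜 S]

/-- The polynomials all of whose coefficients lie in the subalgebra `A`. -/
def coeffsIn (A : Subalgebra 𝕜 S) : Subalgebra A S[X] where
  carrier := {p | ∀ i, p.coeff i ∈ A}
  add_mem' hp hq i := by
    rw [coeff_add]
    exact add_mem (hp i) (hq i)
  mul_mem' hp hq i := by
    rw [coeff_mul]
    exact sum_mem fun x _ => mul_mem (hp x.1) (hq x.2)
  algebraMap_mem' a i := by
    rw [IsScalarTower.algebraMap_apply A S S[X], algebraMap_eq, coeff_C]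
    split_ifs
    exacts [a.2, zero_mem A]

variable {A : Subalgebra 𝕜 S}

theorem coeffsIn_mono {A' : Subalgebra 𝕜 S} (h : A ≤ A') {p : S[X]} (hp : p ∈ coeffsIn A) :
    p ∈ coeffsIn A' := fun i => h (hp i)

theorem C_mem_coeffsIn {a : S} (ha : a ∈ A) : C a ∈ coeffsIn A :=
  (coeffsIn A).algebraMap_mem ⟨a, ha⟩

theorem X_mem_coeffsIn : (X : S[X]) ∈ coeffsIn A := fun i => by
  rw [coeff_X]
  split_ifs
  exacts [one_mem A, zero_mem A]

theorem divByMonic_X_pow_mem_coeffsIn {p : S[X]} (hp : p ∈ coeffsIn A) (n : ℕ) :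
    p /ₘ X ^ n ∈ coeffsIn A := fun i => by
  rw [coeff_divByMonic_X_pow]
  exact hp _

theorem derivative_mem_coeffsIn {p : S[X]} (hp : p ∈ coeffsIn A) : derivative p ∈ coeffsIn A :=
  fun i => by
    rw [coeff_derivative]
    exact mul_mem (hp _) (add_mem (natCast_mem A i) (one_mem A))

theorem dvd_sub_eval₂_of_mem_coeffsIn {f : S →+* S[X]} {d : S[X]} (h : ∀ c ∈ A, d ∣ C c - f c)
    {p : S[X]} (hp : p ∈ coeffsIn A) : d ∣ p - p.eval₂ f X := by
  conv_rhs => rw [p.as_sum_range_C_mul_X_pow, eval₂_finsetSum, ← Finset.sum_sub_distrib]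
  refine Finset.dvd_sum fun i _ => ?_
  rw [eval₂_mul, eval₂_pow, eval₂_X, eval₂_C, ← sub_mul]
  exact (h _ (hp i)).mul_right _

theorem C_mul_sub_reducedMultiple_mem_coeffsIn {p q : S[X]} (hp : p ∈ coeffsIn A)
    (hq : q ∈ coeffsIn A) {κ c : S} (hκ : κ ∈ A) (hc : c ∈ A) (n : ℕ) (w : S) :
    C w * (C κ * (X * derivative p /ₘ X ^ n)) - reducedMultiple n κ w c q p ∈ coeffsIn A := by
  have hp' := derivative_mem_coeffsIn hp
  have hθ := mul_mem (X_mem_coeffsIn (A := A)) hp'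
  have heq : C w * (C κ * (X * derivative p /ₘ X ^ n)) - reducedMultiple n κ w c q p =
      C κ * truncBezout n (X * derivative p) q - C c * derivative p := by
    rw [reducedMultiple]
    ring
  rw [heq]
  exact sub_mem (mul_mem (C_mem_coeffsIn hκ) (sub_mem
      (mul_mem hq (divByMonic_X_pow_mem_coeffsIn hθ n))
      (mul_mem hθ (divByMonic_X_pow_mem_coeffsIn hq n))))
    (mul_mem (C_mem_coeffsIn hc) hp')

end Coefficients

section Reduction

variable {𝕜 S : Type*} [Field 𝕜] [CommRing S] [Algebra 𝕜 S]

/-- The polynomials that are congruent, modulo the submodule `G`, to a polynomial of degree less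
than `n` with coefficients in the subalgebra `A`. -/
def reducible (A : Subalgebra 𝕜 S) (n : ℕ) (G : Submodule S S[X]) : Submodule A S[X] :=
  G.restrictScalars A ⊔
    ((degreeLT S n).restrictScalars A ⊓ Subalgebra.toSubmodule (coeffsIn A))

variable {A : Subalgebra 𝕜 S} {n : ℕ} {G : Submodule S S[X]}

theorem mem_reducible {p : S[X]} :
    p ∈ reducible A n G ↔ ∃ g ∈ G, ∃ q ∈ coeffsIn A, q.degree < n ∧ g + q = p := by
  simp only [reducible, Submodule.mem_sup, Submodule.mem_inf, Submodule.restrictScalars_mem,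
    mem_degreeLT, Subalgebra.mem_toSubmodule, and_assoc, and_left_comm]

theorem mem_reducible_of_sub_mem {p g : S[X]} (hg : g ∈ G) (hp : p.degree < n) (hgn : g.degree < n)
    (h : p - g ∈ coeffsIn A) : p ∈ reducible A n G :=
  mem_reducible.2 ⟨g, hg, p - g, h, (degree_sub_le p g).trans_lt (max_lt hp hgn),
    add_sub_cancel g p⟩

theorem smul_mem_reducible_of_leading {x : S}
    (h : ∀ a < n, ∃ b ∈ coeffsIn A, b.natDegree ≤ a ∧
      (∃ c : 𝕜, c ≠ 0 ∧ b.coeff a = algebraMap 𝕜 S c) ∧ x • b ∈ reducible A n G)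
    {p : S[X]} (hp : p ∈ reducible A n G) : x • p ∈ reducible A n G := by
  have key : ∀ m ≤ n, ∀ q ∈ coeffsIn A, q.degree < m → x • q ∈ reducible A n G := by
    intro m
    induction m with
    | zero =>
      intro _ q _ hq
      obtain rfl : q = 0 := ext fun i => (degree_lt_iff_coeff_zero q 0).1 hq i i.zero_le
      rw [smul_zero]
      exact zero_mem _
    | succ a ih =>
      intro han q hqA hq
      obtain ⟨b, hbA, hba, ⟨c, hc, hbc⟩, hb⟩ := h a han
      let α : A := algebraMap 𝕜 A c⁻¹ * ⟨q.coeff a, hqA a⟩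
      have hα (i : ℕ) : (α • b).coeff i = algebraMap 𝕜 S c⁻¹ * q.coeff a * b.coeff i :=
        coeff_smul (algebraMap 𝕜 S c⁻¹ * q.coeff a) b i
      have hlt : (q - α • b).degree < a := by
        refine (degree_lt_iff_coeff_zero _ a).2 fun i hi => ?_
        rw [coeff_sub, hα]
        obtain rfl | hai := hi.eq_or_lt
        · rw [hbc, mul_right_comm, ← map_mul, inv_mul_cancel₀ hc, map_one, one_mul, sub_self]
        · rw [(degree_lt_iff_coeff_zero q (a + 1)).1 hq i hai,
            coeff_eq_zero_of_natDegree_lt (hba.trans_lt hai), mul_zero, sub_zero]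
      have hsub := ih (by omega) _ (sub_mem hqA ((coeffsIn A).smul_mem hbA α)) hlt
      rw [smul_sub, smul_comm x α b] at hsub
      exact (Submodule.sub_mem_iff_left _ ((reducible A n G).smul_mem α hb)).1 hsub
  obtain ⟨g, hg, q, hqA, hq, rfl⟩ := mem_reducible.1 hp
  rw [smul_add]
  exact add_mem (Submodule.mem_sup_left (G.smul_mem x hg)) (key n le_rfl q hqA hq)

end Reduction

section ReductionMvPolynomial

variable {σ 𝕜 : Type*} [Field 𝕜] {s : Set σ} {n : ℕ}
  {G : Submodule (MvPolynomial σ 𝕜) (MvPolynomial σ 𝕜)[X]}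

theorem mem_reducible_supported_of_degree_lt
    (h : ∀ t ∉ s, ∀ a < n, ∃ b ∈ coeffsIn (MvPolynomial.supported 𝕜 s), b.natDegree ≤ a ∧
      (∃ c : 𝕜, c ≠ 0 ∧ b.coeff a = algebraMap 𝕜 _ c) ∧
      (MvPolynomial.X t : MvPolynomial σ 𝕜) • b ∈ reducible (MvPolynomial.supported 𝕜 s) n G)
    {p : (MvPolynomial σ 𝕜)[X]} (hp : p.degree < n) :
    p ∈ reducible (MvPolynomial.supported 𝕜 s) n G := by
  have hX (t : σ) {q} (hq : q ∈ reducible (MvPolynomial.supported 𝕜 s) n G) :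
      (MvPolynomial.X t : MvPolynomial σ 𝕜) • q ∈ reducible (MvPolynomial.supported 𝕜 s) n G := by
    by_cases ht : t ∈ s
    · exact Submodule.smul_mem _
        (⟨_, MvPolynomial.X_mem_supported.2 ht⟩ : MvPolynomial.supported 𝕜 s) hq
    · exact smul_mem_reducible_of_leading (h t ht) hq
  have hsmul (c : MvPolynomial σ 𝕜) : ∀ q ∈ reducible (MvPolynomial.supported 𝕜 s) n G,
      c • q ∈ reducible (MvPolynomial.supported 𝕜 s) n G := by
    induction c using MvPolynomial.induction_on with
    | C c =>
      exact fun q hq => Submodule.smul_mem _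
        (⟨_, (MvPolynomial.supported 𝕜 s).algebraMap_mem c⟩ : MvPolynomial.supported 𝕜 s) hq
    | add c d hc hd =>
      intro q hq
      rw [add_smul]
      exact add_mem (hc q hq) (hd q hq)
    | mul_X c t hc =>
      intro q hq
      rw [mul_smul]
      exact hc _ (hX t hq)
  rw [p.as_sum_support_C_mul_X_pow]
  refine sum_mem fun i hi => ?_
  have hin : (X ^ i : (MvPolynomial σ 𝕜)[X]).degree < n :=
    (degree_X_pow_le i).trans_lt ((le_degree_of_mem_supp i hi).trans_lt hp)
  rw [← smul_eq_C_mul]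
  exact hsmul _ _ (mem_reducible.2
    ⟨0, zero_mem G, X ^ i, pow_mem X_mem_coeffsIn i, hin, zero_add _⟩)

end ReductionMvPolynomial

theorem eq_of_eval_eq_on_open {σ : Type*} [Finite σ] {s : Set (σ → ℝ)} (hs : IsOpen s)
    (hne : s.Nonempty) {p q : MvPolynomial σ ℝ}
    (h : ∀ x ∈ s, MvPolynomial.eval x p = MvPolynomial.eval x q) : p = q := by
  cases nonempty_fintype σ
  obtain ⟨x₀, hx₀⟩ := hne
  obtain ⟨ε, hε, hb⟩ := Metric.isOpen_iff.1 hs x₀ hx₀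
  refine MvPolynomial.funext_set (fun i => Metric.ball (x₀ i) ε) (fun i => ?_) fun x hx => ?_
  · rw [Real.ball_eq_Ioo]
    exact Set.Ioo_infinite (by linarith)
  · refine h x (hb ?_)
    rw [Metric.mem_ball, dist_pi_lt_iff hε]
    exact fun i => hx i (Set.mem_univ i)

section FinPoly

section Semiring

variable {R : Type*} [Semiring R]

/-- The polynomial `f₁ X + ⋯ + fₙ Xⁿ`, where the index `i` of `Fin n` stands for `i + 1`. -/
def finPoly (n : ℕ) : (Fin n → R) →ₗ[R] R[X] :=
  ∑ i : Fin n, Polynomial.monomial ((i : ℕ) + 1) ∘ₗ LinearMap.proj i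

theorem finPoly_apply {n : ℕ} (f : Fin n → R) :
    finPoly n f = ∑ i : Fin n, C (f i) * X ^ ((i : ℕ) + 1) := by
  simp only [finPoly, LinearMap.sum_apply, LinearMap.comp_apply, LinearMap.proj_apply,
    C_mul_X_pow_eq_monomial]

theorem coeff_finPoly {n : ℕ} (f : Fin n → R) (m : ℕ) :
    (finPoly n f).coeff m = if h : 1 ≤ m ∧ m ≤ n then f ⟨m - 1, by omega⟩ else 0 := by
  simp only [finPoly_apply, finsetSum_coeff, coeff_C_mul_X_pow]
  split_ifs with h
  · rw [Finset.sum_eq_single ⟨m - 1, by omega⟩, if_pos (by simp only; omega)]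
    · intro i _ hi
      exact if_neg fun hm => hi (Fin.ext (by simp only; omega))
    · exact fun hm => absurd (Finset.mem_univ _) hm
  · exact Finset.sum_eq_zero fun i _ => if_neg (by omega)

theorem natDegree_finPoly_le {n : ℕ} (f : Fin n → R) : (finPoly n f).natDegree ≤ n :=
  natDegree_le_iff_coeff_eq_zero.2 fun i hi => by rw [coeff_finPoly, dif_neg (by omega)]

theorem derivative_finPoly {n : ℕ} (f : Fin n → R) :
    derivative (finPoly n f) = ∑ i : Fin n, C (f i * ((i : ℕ) + 1)) * X ^ (i : ℕ) := by
  simp only [finPoly_apply, derivative_sum, derivative_C_mul_X_pow, Nat.cast_add, Nat.cast_one,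
    Nat.add_sub_cancel]

end Semiring

section Ring

variable {R : Type*} [Ring R]

theorem C_sub_finPoly_eq {n : ℕ} {a : ℤ → R} {c : R} {p : R[X]} (hp : p.degree < (n + 1 : ℕ))
    (h₀ : p.coeff 0 = c) (h : ∀ i : ℕ, 1 ≤ i → i ≤ n → p.coeff i = -a i) :
    C c - finPoly n (fun i => a ((i : ℤ) + 1)) = p := by
  ext i
  rw [coeff_sub, coeff_C, coeff_finPoly]
  obtain rfl | hi := i.eq_zero_or_pos
  · simp [h₀]
  rw [if_neg hi.ne', zero_sub]
  split_ifs with hin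
  · rw [h i hi hin.2]
    congr 2
    simp only [Nat.cast_sub hi, Nat.cast_one, sub_add_cancel]
  · rw [(degree_lt_iff_coeff_zero p _).1 hp i (by omega), neg_zero]

theorem degree_C_sub_finPoly_lt {n : ℕ} (c : R) (f : Fin n → R) :
    (C c - finPoly n f).degree < (n + 1 : ℕ) := by
  refine (degree_lt_iff_coeff_zero _ _).2 fun i hi => ?_
  rw [coeff_sub, coeff_C, coeff_finPoly, if_neg (by omega), dif_neg (by omega), sub_zero]

theorem C_sub_finPoly_eq_zero_iff {n : ℕ} {c : R} {f : Fin n → R} :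
    C c - finPoly n f = 0 ↔ c = 0 ∧ f = 0 := by
  refine ⟨fun h => ⟨?_, funext fun i => ?_⟩, ?_⟩
  · simpa [coeff_finPoly] using congrArg (coeff · 0) h
  · simpa [coeff_finPoly, coeff_C] using congrArg (coeff · (i + 1)) h
  · rintro ⟨rfl, rfl⟩
    simp

end Ring

theorem finPoly_mem_coeffsIn {𝕜 R : Type*} [CommRing 𝕜] [CommRing R] [Algebra 𝕜 R]
    {A : Subalgebra 𝕜 R} {n : ℕ} {f : Fin n → R} (hf : ∀ i, f i ∈ A) :
    finPoly n f ∈ coeffsIn A := by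
  rw [finPoly_apply]
  exact sum_mem fun i _ => mul_mem (C_mem_coeffsIn (hf i)) (pow_mem X_mem_coeffsIn _)

end FinPoly

/-! ### The cross cap and its vector fields -/

/-- The polynomial functions on the source. -/
abbrev SrcRing (k : ℕ) := MvPolynomial (Src k) ℝ

/-- The polynomial functions on the target. -/
abbrev TgtRing (k : ℕ) := MvPolynomial (Tgt k) ℝ

/-- The coordinate `y` of the source. -/
def Y (k : ℕ) : SrcRing k := MvPolynomial.X (Sum.inr (Sum.inr ()))

/-- The polynomial `Xᵏ + U_{k-2} X^{k-2} + ⋯ + U₁ X`, which takes the value `W₁` at `y` on the image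
of the cross cap. -/
def polyU (k : ℕ) : (TgtRing k)[X] :=
  X ^ k + finPoly (k - 2) fun i => MvPolynomial.X (Sum.inl i)

/-- The polynomial `V_{k-1} X^{k-1} + ⋯ + V₁ X`, which takes the value `W₂` at `y` on the image of
the cross cap. -/
def polyV (k : ℕ) : (TgtRing k)[X] :=
  finPoly (k - 1) fun i => MvPolynomial.X (Sum.inr (Sum.inl i))

theorem U_zero {k : ℕ} (hk : 2 ≤ k) : U k 0 = 0 := by
  rw [U, dif_neg (by omega), if_neg (by omega)]

theorem U_self (k : ℕ) : U k k = 1 := by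
  rw [U, dif_neg (by omega), if_pos rfl]

theorem V_zero (k : ℕ) : V k 0 = 0 := dif_neg (by omega)

theorem V_self (k : ℕ) : V k k = 0 := dif_neg (by omega)

theorem coeff_polyU (k i : ℕ) : (polyU k).coeff i = U k i := by
  rw [polyU, coeff_add, coeff_X_pow, coeff_finPoly, U]
  by_cases h : 1 ≤ i ∧ i ≤ k - 2
  · rw [dif_pos h, dif_pos (by omega), if_neg (by omega), zero_add]
    congr 3
    omega
  · rw [dif_neg h, dif_neg (by omega), add_zero]
    simp only [Nat.cast_inj]

theorem coeff_polyV (k i : ℕ) : (polyV k).coeff i = V k i := by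
  rw [polyV, coeff_finPoly, V]
  by_cases h : 1 ≤ i ∧ i ≤ k - 1
  · rw [dif_pos h, dif_pos (by omega)]
    congr 4
    omega
  · rw [dif_neg h, dif_neg (by omega)]

theorem natDegree_polyU {k : ℕ} (hk : 2 ≤ k) : (polyU k).natDegree = k := by
  rw [polyU, natDegree_add_eq_left_of_natDegree_lt, natDegree_X_pow]
  exact (natDegree_finPoly_le _).trans_lt (by rw [natDegree_X_pow]; omega)

theorem monic_polyU {k : ℕ} (hk : 2 ≤ k) : (polyU k).Monic := by
  rw [Monic, leadingCoeff, natDegree_polyU hk, coeff_polyU, U_self]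

theorem natDegree_polyV_le (k : ℕ) : (polyV k).natDegree ≤ k - 1 := natDegree_finPoly_le _

/-- Pull-back of polynomial functions along `crossCap k`. -/
def pullback (k : ℕ) : TgtRing k →ₐ[ℝ] SrcRing k :=
  MvPolynomial.aeval (Sum.elim (fun i => MvPolynomial.X (Sum.inl i))
    (Sum.elim (fun i => MvPolynomial.X (Sum.inr (Sum.inl i)))
      ![Y k ^ k + ∑ i : Fin (k - 2), MvPolynomial.X (Sum.inl i) * Y k ^ ((i : ℕ) + 1),
        ∑ i : Fin (k - 1), MvPolynomial.X (Sum.inr (Sum.inl i)) * Y k ^ ((i : ℕ) + 1)]))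

theorem eval_pullback (k : ℕ) (x : Src k → ℝ) (p : TgtRing k) :
    MvPolynomial.eval x (pullback k p) = MvPolynomial.eval (crossCap k x) p := by
  have h : (MvPolynomial.aeval x).comp (pullback k) = MvPolynomial.aeval (crossCap k x) := by
    ext t
    rcases t with i | i | i
    · simp [pullback, crossCap]
    · simp [pullback, crossCap]
    · fin_cases i <;> simp [pullback, crossCap, Y]
  simpa [MvPolynomial.aeval_eq_eval] using DFunLike.congr_fun h p

/-- Restriction of a polynomial in one variable over the target to the graph of the cross cap: the
coefficients are pulled back and the variable is replaced by `y`. -/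
def graphEval (k : ℕ) : (TgtRing k)[X] →+* SrcRing k :=
  eval₂RingHom (pullback k : TgtRing k →+* SrcRing k) (Y k)

theorem graphEval_C {k : ℕ} (p : TgtRing k) : graphEval k (C p) = pullback k p :=
  eval₂_C _ _

theorem graphEval_X (k : ℕ) : graphEval k X = Y k := eval₂_X _ _

theorem graphEval_finPoly {k n : ℕ} (f : Fin n → TgtRing k) :
    graphEval k (finPoly n f) = ∑ i, pullback k (f i) * Y k ^ ((i : ℕ) + 1) := by
  simp only [finPoly_apply, map_sum, map_mul, map_pow, graphEval_C, graphEval_X]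

theorem graphEval_W₁_sub_polyU (k : ℕ) : graphEval k (C (W₁ k) - polyU k) = 0 := by
  rw [map_sub, sub_eq_zero, graphEval_C, polyU, map_add, map_pow, graphEval_X, graphEval_finPoly]
  simp [W₁, pullback]

theorem graphEval_W₂_sub_polyV (k : ℕ) : graphEval k (C (W₂ k) - polyV k) = 0 := by
  rw [map_sub, sub_eq_zero, graphEval_C, polyV, graphEval_finPoly]
  simp [W₂, pullback]

theorem graphEval_derivative_polyU (k : ℕ) : graphEval k (derivative (polyU k)) =
    k * Y k ^ (k - 1) +
      ∑ i : Fin (k - 2), MvPolynomial.X (Sum.inl i) *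
        ((((i : ℕ) : SrcRing k) + 1) * Y k ^ (i : ℕ)) := by
  simp [polyU, derivative_X_pow, derivative_finPoly, graphEval_C, graphEval_X, pullback, mul_assoc]

theorem graphEval_derivative_polyV (k : ℕ) : graphEval k (derivative (polyV k)) =
    ∑ i : Fin (k - 1), MvPolynomial.X (Sum.inr (Sum.inl i)) *
      ((((i : ℕ) : SrcRing k) + 1) * Y k ^ (i : ℕ)) := by
  simp [polyV, derivative_finPoly, graphEval_C, graphEval_X, pullback, mul_assoc]

/-- The polynomial `C₁ - A₁ X - ⋯ - A_{k-2} X^{k-2}` of a vector field. When the field lifts to `η`,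
its value on the graph is `η_y` times that of the derivative of `polyU k`. -/
def symb₁ (k : ℕ) : PolyField (Tgt k) →ₗ[TgtRing k] (TgtRing k)[X] :=
  Polynomial.monomial 0 ∘ₗ LinearMap.proj (Sum.inr (Sum.inr 0)) -
    finPoly (k - 2) ∘ₗ LinearMap.funLeft _ _ Sum.inl

/-- The polynomial `C₂ - B₁ X - ⋯ - B_{k-1} X^{k-1}` of a vector field. -/
def symb₂ (k : ℕ) : PolyField (Tgt k) →ₗ[TgtRing k] (TgtRing k)[X] :=
  Polynomial.monomial 0 ∘ₗ LinearMap.proj (Sum.inr (Sum.inr 1)) -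
    finPoly (k - 1) ∘ₗ LinearMap.funLeft _ _ (Sum.inr ∘ Sum.inl)

theorem symb₁_apply {k : ℕ} (ξ : PolyField (Tgt k)) :
    symb₁ k ξ = C (ξ (Sum.inr (Sum.inr 0))) - finPoly (k - 2) fun i => ξ (Sum.inl i) := rfl

theorem symb₂_apply {k : ℕ} (ξ : PolyField (Tgt k)) :
    symb₂ k ξ = C (ξ (Sum.inr (Sum.inr 1))) - finPoly (k - 1) fun i => ξ (Sum.inr (Sum.inl i)) :=
  rfl

theorem eq_zero_of_symb_eq_zero {k : ℕ} {ξ : PolyField (Tgt k)} (h₁ : symb₁ k ξ = 0)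
    (h₂ : symb₂ k ξ = 0) : ξ = 0 := by
  obtain ⟨hC₁, hA⟩ := C_sub_finPoly_eq_zero_iff.1 h₁
  obtain ⟨hC₂, hB⟩ := C_sub_finPoly_eq_zero_iff.1 h₂
  funext t
  rcases t with i | i | i
  · exact congrFun hA i
  · exact congrFun hB i
  · fin_cases i
    exacts [hC₁, hC₂]

theorem degree_symb₁_lt {k : ℕ} (hk : 2 ≤ k) (ξ : PolyField (Tgt k)) :
    (symb₁ k ξ).degree < (k - 1 : ℕ) := by
  rw [symb₁_apply]
  exact (degree_C_sub_finPoly_lt _ _).trans_eq (congrArg Nat.cast (by omega))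

theorem degree_symb₂_lt {k : ℕ} (hk : 2 ≤ k) (ξ : PolyField (Tgt k)) :
    (symb₂ k ξ).degree < k := by
  rw [symb₂_apply]
  exact (degree_C_sub_finPoly_lt _ _).trans_eq (congrArg Nat.cast (by omega))

theorem fderiv_crossCap (k : ℕ) (x η : Src k → ℝ) :
    fderiv ℝ (crossCap k) x η =
      Sum.elim (fun i => η (Sum.inl i)) (Sum.elim (fun i => η (Sum.inr (Sum.inl i)))
        ![η (Sum.inr (Sum.inr ())) * MvPolynomial.eval x (graphEval k (derivative (polyU k))) +
            ∑ i : Fin (k - 2), η (Sum.inl i) * x (Sum.inr (Sum.inr ())) ^ ((i : ℕ) + 1),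
          η (Sum.inr (Sum.inr ())) * MvPolynomial.eval x (graphEval k (derivative (polyV k))) +
            ∑ i : Fin (k - 1), η (Sum.inr (Sum.inl i)) *
              x (Sum.inr (Sum.inr ())) ^ ((i : ℕ) + 1)]) := by
  have hd : DifferentiableAt ℝ (crossCap k) x :=
    ((contDiff_crossCap k).differentiable (by simp)).differentiableAt
  have hcoord (t : Src k) : HasFDerivAt (fun z : Src k → ℝ => z t)
      (ContinuousLinearMap.proj (R := ℝ) (φ := fun _ : Src k => ℝ) t) x :=
    hasFDerivAt_apply t x
  have hterm {n : ℕ} (t : Fin n → Src k) := HasFDerivAt.fun_sum (u := Finset.univ) fun i _ =>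
    (hcoord (t i)).mul ((hcoord (Sum.inr (Sum.inr ()))).pow ((i : ℕ) + 1))
  funext t
  have hcomp (L : (Src k → ℝ) →L[ℝ] ℝ) (hL : HasFDerivAt (fun z => crossCap k z t) L x) :
      fderiv ℝ (crossCap k) x η t = L η := by
    rw [← (hasFDerivAt_pi'.1 hd.hasFDerivAt t).unique hL]
    rfl
  rcases t with i | i | i
  · exact hcomp _ (hcoord _)
  · exact hcomp _ (hcoord _)
  · fin_cases i
    · refine (hcomp _ (((hcoord (Sum.inr (Sum.inr ()))).pow k).add (hterm Sum.inl))).trans ?_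
      simp only [nsmul_eq_mul, add_tsub_cancel_right, Nat.cast_add, Nat.cast_one,
        Finset.sum_add_distrib, add_apply, smul_apply, ContinuousLinearMap.proj_apply,
        smul_eq_mul, sum_apply, graphEval_derivative_polyU, Y, map_add, map_mul, map_natCast,
        map_pow, MvPolynomial.eval_X, map_sum, map_one, mul_add, Finset.mul_sum, Fin.zero_eta,
        Sum.elim_inr, Matrix.cons_val_zero]
      simp only [mul_comm, mul_left_comm, add_assoc]
    · refine (hcomp _ (hterm (Sum.inr ∘ Sum.inl))).trans ?_
      simp only [Function.comp_apply, add_tsub_cancel_right, nsmul_eq_mul, Nat.cast_add,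
        Nat.cast_one, Finset.sum_add_distrib, add_apply, sum_apply, smul_apply,
        ContinuousLinearMap.proj_apply, smul_eq_mul, graphEval_derivative_polyV, Y, map_sum,
        map_mul, MvPolynomial.eval_X, map_add, map_natCast, map_one, map_pow, Finset.mul_sum,
        Fin.mk_one, Sum.elim_inr, Matrix.cons_val_one, Matrix.cons_val_fin_one]
      simp only [mul_comm, mul_left_comm]

theorem eval_graphEval_symb₁ {k : ℕ} (ξ : PolyField (Tgt k)) (x : Src k → ℝ) :
    MvPolynomial.eval x (graphEval k (symb₁ k ξ)) =
      ξ.toFun (crossCap k x) (Sum.inr (Sum.inr 0)) - ∑ i : Fin (k - 2),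
        ξ.toFun (crossCap k x) (Sum.inl i) * x (Sum.inr (Sum.inr ())) ^ ((i : ℕ) + 1) := by
  simp only [symb₁_apply, map_sub, map_sum, map_mul, map_pow, graphEval_C, graphEval_finPoly,
    eval_pullback, Y, MvPolynomial.eval_X, PolyField.toFun]

theorem eval_graphEval_symb₂ {k : ℕ} (ξ : PolyField (Tgt k)) (x : Src k → ℝ) :
    MvPolynomial.eval x (graphEval k (symb₂ k ξ)) =
      ξ.toFun (crossCap k x) (Sum.inr (Sum.inr 1)) - ∑ i : Fin (k - 1),
        ξ.toFun (crossCap k x) (Sum.inr (Sum.inl i)) *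
          x (Sum.inr (Sum.inr ())) ^ ((i : ℕ) + 1) := by
  simp only [symb₂_apply, map_sub, map_sum, map_mul, map_pow, graphEval_C, graphEval_finPoly,
    eval_pullback, Y, MvPolynomial.eval_X, PolyField.toFun]

theorem fderiv_crossCap_eq_iff {k : ℕ} (ξ : PolyField (Tgt k)) (x η : Src k → ℝ) :
    fderiv ℝ (crossCap k) x η = ξ.toFun (crossCap k x) ↔
      (∀ i, η (Sum.inl i) = ξ.toFun (crossCap k x) (Sum.inl i)) ∧
      (∀ i, η (Sum.inr (Sum.inl i)) = ξ.toFun (crossCap k x) (Sum.inr (Sum.inl i))) ∧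
      MvPolynomial.eval x (graphEval k (symb₁ k ξ)) = η (Sum.inr (Sum.inr ())) *
        MvPolynomial.eval x (graphEval k (derivative (polyU k))) ∧
      MvPolynomial.eval x (graphEval k (symb₂ k ξ)) = η (Sum.inr (Sum.inr ())) *
        MvPolynomial.eval x (graphEval k (derivative (polyV k))) := by
  rw [fderiv_crossCap, eval_graphEval_symb₁, eval_graphEval_symb₂, funext_iff]
  simp only [Sum.forall, Fin.forall_fin_two, Sum.elim_inl, Sum.elim_inr, Matrix.cons_val_zero,
    Matrix.cons_val_one]
  refine and_congr_right fun hA => and_congr_right fun hB => ?_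
  simp only [hA, hB, sub_eq_iff_eq_add, eq_comm]

theorem graphEval_derivative_polyU_ne_zero {k : ℕ} (hk : 2 ≤ k) :
    graphEval k (derivative (polyU k)) ≠ 0 := by
  intro h
  have h' := congrArg (MvPolynomial.eval (Sum.elim 0 (Sum.elim 0 1) : Src k → ℝ)) h
  have hk₀ : k ≠ 0 := by omega
  simp [graphEval_derivative_polyU, Y, hk₀] at h'

theorem graphEval_derivative_polyV_eq_X_add {k : ℕ} (hk : 2 ≤ k) :
    ∃ r ∈ MvPolynomial.supported ℝ {(Sum.inr (Sum.inl ⟨0, by omega⟩) : Src k)}ᶜ,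
      graphEval k (derivative (polyV k)) =
        MvPolynomial.X (Sum.inr (Sum.inl ⟨0, by omega⟩)) + r := by
  have hv₁ : (⟨0, by omega⟩ : Fin (k - 1)) ∈ Finset.univ := Finset.mem_univ _
  have h := graphEval_derivative_polyV k
  rw [← Finset.add_sum_erase _ _ hv₁, Nat.cast_zero, zero_add, pow_zero, mul_one, mul_one] at h
  refine ⟨_, sum_mem fun i hi => ?_, h⟩
  refine mul_mem (MvPolynomial.X_mem_supported.2 ?_)
    (mul_mem (add_mem (natCast_mem _ _) (one_mem _)) (pow_mem ?_ _))
  · simpa using Finset.ne_of_mem_erase hi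
  · exact MvPolynomial.X_mem_supported.2 (by simp)

theorem exists_eq_mul_derivative_of_mul_eq_mul {k : ℕ} (hk : 2 ≤ k) {p q : SrcRing k}
    (h : p * graphEval k (derivative (polyV k)) = q * graphEval k (derivative (polyU k))) :
    ∃ g, p = g * graphEval k (derivative (polyU k)) ∧
      q = g * graphEval k (derivative (polyV k)) := by
  obtain ⟨r, hr, hV⟩ := graphEval_derivative_polyV_eq_X_add hk
  rw [hV] at h ⊢
  refine exists_common_factor_of_mul_X_add_eq_mul hr ?_ (graphEval_derivative_polyU_ne_zero hk) h
  rw [graphEval_derivative_polyU]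
  have hY : Y k ∈ MvPolynomial.supported ℝ {(Sum.inr (Sum.inl ⟨0, by omega⟩) : Src k)}ᶜ :=
    MvPolynomial.X_mem_supported.2 (by simp)
  exact add_mem (mul_mem (natCast_mem _ _) (pow_mem hY _)) <| sum_mem fun i _ =>
    mul_mem (MvPolynomial.X_mem_supported.2 (by simp))
      (mul_mem (add_mem (natCast_mem _ _) (one_mem _)) (pow_mem hY _))

theorem mem_liftable_iff {k : ℕ} (hk : 2 ≤ k) (ξ : PolyField (Tgt k)) :
    ξ ∈ liftablePolyFields (crossCap k) (contDiff_crossCap k) ↔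
      ∃ h : SrcRing k, graphEval k (symb₁ k ξ) = h * graphEval k (derivative (polyU k)) ∧
        graphEval k (symb₂ k ξ) = h * graphEval k (derivative (polyV k)) := by
  constructor
  · rintro ⟨s, hs, h0, η, -, hη⟩
    apply exists_eq_mul_derivative_of_mul_eq_mul hk
    refine eq_of_eval_eq_on_open hs ⟨0, h0⟩ fun x hx => ?_
    obtain ⟨-, -, h₁, h₂⟩ := (fderiv_crossCap_eq_iff ξ x (η x)).1 (hη x hx)
    rw [map_mul, map_mul, h₁, h₂]
    ring
  · rintro ⟨h, h₁, h₂⟩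
    refine ⟨Set.univ, isOpen_univ, Set.mem_univ _, fun x =>
      Sum.elim (fun i => ξ.toFun (crossCap k x) (Sum.inl i))
        (Sum.elim (fun i => ξ.toFun (crossCap k x) (Sum.inr (Sum.inl i)))
          fun _ => MvPolynomial.eval x h),
      ContDiff.contDiffOn (contDiff_pi.2 ?_), fun x _ => ?_⟩
    · rintro (_ | _ | _)
      · exact (contDiff_eval _).comp (contDiff_crossCap k)
      · exact (contDiff_eval _).comp (contDiff_crossCap k)
      · exact contDiff_eval h
    · refine (fderiv_crossCap_eq_iff ξ x _).2 ⟨fun _ => rfl, fun _ => rfl, ?_, ?_⟩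
      · rw [h₁, map_mul]
        rfl
      · rw [h₂, map_mul]
        rfl

/-! ### The generators -/

theorem U_pred (k : ℕ) : U k ((k : ℤ) - 1) = 0 := by
  rw [U, dif_neg (by omega), if_neg (by omega)]

theorem coeff_polyU_pred {k : ℕ} (hk : 2 ≤ k) : (polyU k).coeff (k - 1) = 0 := by
  rw [coeff_polyU, Nat.cast_sub (by omega), Nat.cast_one, U_pred]

theorem coeff_polyU_self (k : ℕ) : (polyU k).coeff k = 1 := by
  rw [coeff_polyU, U_self]

theorem symb₁_tuple_eq {k : ℕ} (hk : 2 ≤ k) {A : ℤ → TgtRing k} {c₁ : TgtRing k}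
    {p : (TgtRing k)[X]} (hp : p.natDegree ≤ k - 1) (htop : p.coeff (k - 1) = 0)
    (h₀ : p.coeff 0 = c₁) (h : ∀ i : ℕ, 1 ≤ i → p.coeff i = -A i) (B : ℤ → TgtRing k)
    (c₂ : TgtRing k) : symb₁ k (tuple k A B c₁ c₂) = p :=
  C_sub_finPoly_eq ((degree_lt_of_natDegree_le_of_coeff_eq_zero hp htop).trans_eq
    (congrArg Nat.cast (by omega))) h₀ fun i hi _ => h i hi

theorem symb₂_tuple_eq {k : ℕ} {B : ℤ → TgtRing k} {c₂ : TgtRing k}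
    {p : (TgtRing k)[X]} (hp : p.natDegree ≤ k - 1) (h₀ : p.coeff 0 = c₂)
    (h : ∀ i : ℕ, 1 ≤ i → p.coeff i = -B i) (A : ℤ → TgtRing k) (c₁ : TgtRing k) :
    symb₂ k (tuple k A B c₁ c₂) = p :=
  C_sub_finPoly_eq ((degree_le_of_natDegree_le hp).trans_lt
    (Nat.cast_lt.2 (by omega))) h₀ fun i hi _ => h i hi

theorem symb₁_eulerField {k : ℕ} (hk : 2 ≤ k) :
    symb₁ k (eulerField k) =
      C (k : TgtRing k) * (C (W₁ k) - polyU k) + X * derivative (polyU k) := by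
  have hcoeff (i : ℕ) (hi : 1 ≤ i) :
      (C (k : TgtRing k) * (C (W₁ k) - polyU k) + X * derivative (polyU k)).coeff i =
        -(((k - i : ℤ) : TgtRing k) * U k i) := by
    rw [coeff_add, coeff_C_mul, coeff_sub, coeff_C_of_ne_zero (by omega), coeff_X_mul_derivative,
      coeff_polyU]
    push_cast
    ring
  refine symb₁_tuple_eq hk (natDegree_le_iff_coeff_eq_zero.2 fun i hi => ?_) ?_ ?_ hcoeff _ _
  · rw [hcoeff i (by omega)]
    obtain rfl | hne := eq_or_ne i k
    · rw [sub_self, Int.cast_zero, zero_mul, neg_zero]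
    · rw [← coeff_polyU, coeff_eq_zero_of_natDegree_lt
        ((natDegree_polyU hk).trans_lt (by omega)), mul_zero, neg_zero]
  · rw [hcoeff _ (by omega), ← coeff_polyU, coeff_polyU_pred hk, mul_zero, neg_zero]
  · rw [coeff_add, coeff_C_mul, coeff_sub, coeff_C_zero, coeff_X_mul_derivative, coeff_polyU,
      Nat.cast_zero, U_zero hk]
    simp only [Nat.cast_zero, mul_zero, sub_zero, add_zero]

theorem symb₂_eulerField (k : ℕ) :
    symb₂ k (eulerField k) =
      C (k : TgtRing k) * (C (W₂ k) - polyV k) + X * derivative (polyV k) := by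
  have hV := natDegree_polyV_le k
  refine symb₂_tuple_eq ?_ ?_ (fun i hi => ?_) _ _
  · refine natDegree_add_le_of_degree_le ?_ ((natDegree_X_mul_derivative_le _).trans hV)
    exact (natDegree_C_mul_le _ _).trans (natDegree_sub_le_of_le (natDegree_C _).le hV |>.trans
      (by omega))
  · rw [coeff_add, coeff_C_mul, coeff_sub, coeff_C_zero, coeff_X_mul_derivative, coeff_polyV,
      Nat.cast_zero, V_zero]
    simp only [Nat.cast_zero, mul_zero, sub_zero, add_zero]
  · rw [coeff_add, coeff_C_mul, coeff_sub, coeff_C_of_ne_zero (by omega), coeff_X_mul_derivative,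
      coeff_polyV]
    push_cast
    ring

theorem symb₁_xi₁ (k : ℕ) (j : ℤ) :
    symb₁ k (xi₁ k j) = (((k - j : ℤ) : TgtRing k) * U k j) • symb₁ k (eulerField k) := by
  rw [← map_smul, symb₁_apply, symb₁_apply]
  congr 2
  · simp only [xi₁, eulerField, tuple, Sum.elim_inr, Matrix.cons_val_zero, Pi.smul_apply,
      smul_eq_mul]
    push_cast
    ring
  · funext i
    simp only [xi₁, eulerField, tuple, Sum.elim_inl, Pi.smul_apply, smul_eq_mul]
    push_cast
    ring

theorem symb₂_xi₁ {k : ℕ} {j : ℕ} (hj : j ≠ 0) (hjk : j < k) :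
    symb₂ k (xi₁ k j) = C (k : TgtRing k) * (C (W₂ k) * (polyU k /ₘ X ^ j) -
        C (W₁ k) * (polyV k /ₘ X ^ j) - truncBezout j (polyU k) (polyV k)) +
      C (((k - j : ℤ) : TgtRing k) * U k j) * (X * derivative (polyV k)) -
      C ((j : TgtRing k) * U k j) * (C (W₂ k) - polyV k) := by
  have hk : 2 ≤ k := by omega
  have hU := natDegree_polyU hk
  have hV := natDegree_polyV_le k
  obtain ⟨n, rfl⟩ := Nat.exists_eq_succ_of_ne_zero hj
  have hcoeff := fun i =>
    coeff_mul_divByMonic_X_pow (coeff_polyU k) (coeff_polyV k) (V_zero k) (n + 1) i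
  have hcoeff' := fun i =>
    coeff_mul_divByMonic_X_pow (coeff_polyV k) (coeff_polyU k) (U_zero hk) (n + 1) i
  refine symb₂_tuple_eq ?_ ?_ (fun i hi => ?_) _ _
  · refine natDegree_sub_le_of_le (natDegree_add_le_of_degree_le ?_ ?_) ?_ |>.trans_eq (max_self _)
    · exact (natDegree_C_mul_le _ _).trans <| natDegree_sub_le_of_le (natDegree_sub_le_of_le
        ((natDegree_C_mul_le _ _).trans (natDegree_divByMonic_X_pow_le (m := k - 1) (by omega)))
        ((natDegree_C_mul_le _ _).trans (natDegree_divByMonic_X_pow_le (m := k - 1) (by omega))))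
        (natDegree_truncBezout_le (d := k) (by omega) hU.le (by omega)) |>.trans (by simp)
    · exact (natDegree_C_mul_le _ _).trans ((natDegree_X_mul_derivative_le _).trans hV)
    · exact (natDegree_C_mul_le _ _).trans
        ((natDegree_sub_le_of_le (natDegree_C _).le hV).trans (by simp))
  · simp only [truncBezout, coeff_add, coeff_sub, coeff_C_mul, coeff_C_zero, hcoeff, hcoeff',
      coeff_divByMonic_X_pow, coeff_polyU, coeff_polyV, coeff_X_mul_derivative]
    simp only [V_zero, Nat.cast_zero, Finset.Icc_eq_empty_of_lt (zero_lt_one' ℤ), Finset.sum_empty]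
    push_cast
    ring_nf
  · simp only [truncBezout, Nat.succ_eq_add_one, coeff_add, coeff_sub, coeff_C_mul,
      coeff_C_of_ne_zero (Nat.pos_iff_ne_zero.1 hi), hcoeff, hcoeff',
      coeff_divByMonic_X_pow, coeff_polyU, coeff_polyV, coeff_X_mul_derivative]
    rw [sum_Icc_one_eq_add_sum_Icc_sub_one (by omega) fun r => V k r * _]
    simp only [mul_comm (V k _) (U k _), add_comm (i : ℤ)]
    push_cast
    ring_nf

theorem coeff_pred_reducedMultiple_polyU {k m : ℕ} (hm : m ≠ 0) (hmk : m < k) {q : (TgtRing k)[X]}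
    (hq : q.natDegree ≤ k) (w c : TgtRing k) :
    (reducedMultiple (m + 1) (k : TgtRing k) w c q (polyU k)).coeff (k - 1) =
      k * (m * U k m * q.coeff k + c - k * q.coeff m) := by
  rw [coeff_reducedMultiple_top hm hmk (natDegree_polyU (by omega)).le hq, coeff_polyU,
    coeff_polyU_self]
  ring

section

variable {k m : ℕ}

theorem sub_index_add_one (i : ℤ) : (k : ℤ) + i - (k - m) + 1 = (m + 1 : ℕ) + i := by
  push_cast
  ring

theorem sub_index_sub_add_one (i r : ℤ) :
    (k : ℤ) + i - (k - m) - r + 1 = (m + 1 : ℕ) + i - r := by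
  push_cast
  ring

theorem symb₁_xi₂ (hm : m ≠ 0) (hmk : m < k) :
    symb₁ k (xi₂ k (k - m)) = reducedMultiple (m + 1) (k : TgtRing k) (W₁ k)
      (((k - m : ℤ) : TgtRing k) * U k m) (polyU k) (polyU k) := by
  have hk : 2 ≤ k := by omega
  have hU := (natDegree_polyU hk).le
  refine symb₁_tuple_eq hk (natDegree_reducedMultiple_le hmk hU hU _ _ _) ?_ ?_ (fun i _ => ?_) _ _
  · rw [coeff_pred_reducedMultiple_polyU hm hmk hU, coeff_polyU_self, coeff_polyU]
    push_cast
    ring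
  · rw [coeff_zero_reducedMultiple ((coeff_polyU k 0).trans (U_zero hk)), coeff_polyU, coeff_polyU]
    push_cast
    ring_nf
  · rw [coeff_reducedMultiple (coeff_polyU k) (coeff_polyU k) (U_zero hk)]
    simp only [sub_index_add_one, sub_index_sub_add_one, sub_sub_cancel, sum_sub_two_mul]
    push_cast
    ring

theorem symb₂_xi₂ (hm : m ≠ 0) (hmk : m < k) :
    symb₂ k (xi₂ k (k - m)) = reducedMultiple (m + 1) (k : TgtRing k) (W₁ k)
      (((k - m : ℤ) : TgtRing k) * U k m) (polyU k) (polyV k) := by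
  have hk : 2 ≤ k := by omega
  have hU := (natDegree_polyU hk).le
  have hV := (natDegree_polyV_le k).trans (Nat.sub_le k 1)
  refine symb₂_tuple_eq (natDegree_reducedMultiple_le hmk hV hU _ _ _) ?_ (fun i _ => ?_) _ _
  · rw [coeff_zero_reducedMultiple ((coeff_polyU k 0).trans (U_zero hk)), coeff_polyV, coeff_polyV]
    push_cast
    ring_nf
  · rw [coeff_reducedMultiple (coeff_polyV k) (coeff_polyU k) (U_zero hk)]
    simp only [sub_index_add_one, sub_index_sub_add_one, sub_sub_cancel,
      mul_comm, mul_left_comm, mul_assoc]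
    push_cast
    ring

theorem symb₁_xi₃ (hm : m ≠ 0) (hmk : m < k) :
    symb₁ k (xi₃ k (k - m)) = reducedMultiple (m + 1) (k : TgtRing k) (W₂ k)
      (k * V k m) (polyV k) (polyU k) := by
  have hk : 2 ≤ k := by omega
  have hU := (natDegree_polyU hk).le
  have hV := (natDegree_polyV_le k).trans (Nat.sub_le k 1)
  refine symb₁_tuple_eq hk (natDegree_reducedMultiple_le hmk hU hV _ _ _) ?_ ?_ (fun i _ => ?_) _ _
  · rw [coeff_pred_reducedMultiple_polyU hm hmk hV, coeff_polyV, coeff_polyV, V_self]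
    ring
  · rw [coeff_zero_reducedMultiple ((coeff_polyV k 0).trans (V_zero k)), coeff_polyU, coeff_polyU]
    push_cast
    ring_nf
  · rw [coeff_reducedMultiple (coeff_polyU k) (coeff_polyV k) (V_zero k)]
    simp only [sub_index_add_one, sub_index_sub_add_one, sub_sub_cancel,
      mul_comm, mul_left_comm, mul_assoc]
    push_cast
    ring

theorem symb₂_xi₃ (hmk : m < k) :
    symb₂ k (xi₃ k (k - m)) = reducedMultiple (m + 1) (k : TgtRing k) (W₂ k)
      (k * V k m) (polyV k) (polyV k) := by
  have hV := (natDegree_polyV_le k).trans (Nat.sub_le k 1)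
  refine symb₂_tuple_eq (natDegree_reducedMultiple_le hmk hV hV _ _ _) ?_ (fun i _ => ?_) _ _
  · rw [coeff_zero_reducedMultiple ((coeff_polyV k 0).trans (V_zero k)), coeff_polyV, coeff_polyV]
    push_cast
    ring_nf
  · rw [coeff_reducedMultiple (coeff_polyV k) (coeff_polyV k) (V_zero k)]
    simp only [sub_index_add_one, sub_index_sub_add_one, sub_sub_cancel, sum_sub_two_mul]
    push_cast
    ring

end

theorem graphEval_reducedMultiple {k n : ℕ} {κ w c : TgtRing k} {q : (TgtRing k)[X]}
    (h : graphEval k (C w - q) = 0) (p : (TgtRing k)[X]) :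
    graphEval k (reducedMultiple n κ w c q p) =
      graphEval k (C κ * X * (q /ₘ X ^ n) + C c) * graphEval k (derivative p) := by
  rw [reducedMultiple_eq, map_add, map_mul _ _ (C w - q), h, mul_zero, zero_add, map_mul]

theorem eulerField_mem_liftable {k : ℕ} (hk : 2 ≤ k) :
    eulerField k ∈ liftablePolyFields (crossCap k) (contDiff_crossCap k) := by
  refine (mem_liftable_iff hk _).2 ⟨Y k, ?_, ?_⟩
  · rw [symb₁_eulerField hk, map_add, map_mul, graphEval_W₁_sub_polyU, mul_zero, zero_add, map_mul,
      graphEval_X]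
  · rw [symb₂_eulerField, map_add, map_mul, graphEval_W₂_sub_polyV, mul_zero, zero_add, map_mul,
      graphEval_X]

/-- The combination of `ξ¹ⱼ` with the Euler field whose lift has vanishing `y`-component. -/
def xi₁Reduced (k j : ℕ) : PolyField (Tgt k) :=
  xi₁ k j - (((k - j : ℤ) : TgtRing k) * U k j) • eulerField k

theorem symb₁_xi₁Reduced (k j : ℕ) : symb₁ k (xi₁Reduced k j) = 0 := by
  rw [xi₁Reduced, map_sub, map_smul, symb₁_xi₁, sub_self]

theorem symb₂_xi₁Reduced {k j : ℕ} (hj : j ≠ 0) (hjk : j < k) :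
    symb₂ k (xi₁Reduced k j) =
      (C (k : TgtRing k) * (polyU k /ₘ X ^ j) - C ((j + k * (k - j) : TgtRing k) * U k j)) *
        (C (W₂ k) - polyV k) -
      C (k : TgtRing k) * (polyV k /ₘ X ^ j) * (C (W₁ k) - polyU k) := by
  rw [xi₁Reduced, map_sub, map_smul, symb₂_xi₁ hj hjk, symb₂_eulerField, smul_eq_C_mul, truncBezout]
  push_cast
  simp only [map_mul, map_add, map_sub]
  ring

theorem xi₁_mem_liftable {k j : ℕ} (hj : j ≠ 0) (hjk : j < k) :
    xi₁ k j ∈ liftablePolyFields (crossCap k) (contDiff_crossCap k) := by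
  have hk : 2 ≤ k := by omega
  have hmem : xi₁Reduced k j ∈ liftablePolyFields (crossCap k) (contDiff_crossCap k) := by
    refine (mem_liftable_iff hk _).2 ⟨0, ?_, ?_⟩
    · rw [symb₁_xi₁Reduced, map_zero, zero_mul]
    · rw [symb₂_xi₁Reduced hj hjk, map_sub, map_mul _ _ (C (W₂ k) - polyV k),
        map_mul _ _ (C (W₁ k) - polyU k), graphEval_W₁_sub_polyU, graphEval_W₂_sub_polyV,
        mul_zero, mul_zero, sub_zero, zero_mul]
  exact (Submodule.sub_mem_iff_left _
    (Submodule.smul_mem _ _ (eulerField_mem_liftable hk))).1 hmem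

theorem mem_liftable_of_symb_eq_reducedMultiple {k n : ℕ} (hk : 2 ≤ k) {ξ : PolyField (Tgt k)}
    {κ w c : TgtRing k} {q : (TgtRing k)[X]} (hq : graphEval k (C w - q) = 0)
    (h₁ : symb₁ k ξ = reducedMultiple n κ w c q (polyU k))
    (h₂ : symb₂ k ξ = reducedMultiple n κ w c q (polyV k)) :
    ξ ∈ liftablePolyFields (crossCap k) (contDiff_crossCap k) :=
  (mem_liftable_iff hk ξ).2
    ⟨_, h₁ ▸ graphEval_reducedMultiple hq _, h₂ ▸ graphEval_reducedMultiple hq _⟩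

theorem xi₂_mem_liftable {k m : ℕ} (hm : m ≠ 0) (hmk : m < k) :
    xi₂ k (k - m) ∈ liftablePolyFields (crossCap k) (contDiff_crossCap k) :=
  mem_liftable_of_symb_eq_reducedMultiple (by omega) (graphEval_W₁_sub_polyU k)
    (symb₁_xi₂ hm hmk) (symb₂_xi₂ hm hmk)

theorem xi₃_mem_liftable {k m : ℕ} (hm : m ≠ 0) (hmk : m < k) :
    xi₃ k (k - m) ∈ liftablePolyFields (crossCap k) (contDiff_crossCap k) :=
  mem_liftable_of_symb_eq_reducedMultiple (by omega) (graphEval_W₂_sub_polyV k)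
    (symb₁_xi₃ hm hmk) (symb₂_xi₃ hmk)

theorem span_generators_le {k : ℕ} (hk : 2 ≤ k) :
    Submodule.span (TgtRing k) (generators k) ≤
      liftablePolyFields (crossCap k) (contDiff_crossCap k) := by
  refine Submodule.span_le.2 (Set.union_subset ?_ (Set.iUnion₂_subset fun j hj => ?_))
  · exact Set.singleton_subset_iff.2 (eulerField_mem_liftable hk)
  obtain ⟨hj₁, hjk⟩ := hj
  obtain ⟨n, rfl⟩ := Int.eq_ofNat_of_zero_le (by omega : 0 ≤ j)
  have hsub : (n : ℤ) = k - (k - n : ℕ) := by omega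
  rintro _ (rfl | rfl | rfl)
  · exact xi₁_mem_liftable (by omega) (by omega)
  · rw [hsub]
    exact xi₂_mem_liftable (by omega) (by omega)
  · rw [hsub]
    exact xi₃_mem_liftable (by omega) (by omega)

/-! ### Completeness of the generators -/

/-- The pull-back to the source, written with `y` as the polynomial variable: it inverts
`graphEval k` on the polynomials whose coefficients do not involve `W₁` and `W₂`. -/
def graphSection (k : ℕ) : SrcRing k →ₐ[ℝ] (TgtRing k)[X] :=
  MvPolynomial.aeval (Sum.elim (fun i => C (MvPolynomial.X (Sum.inl i)))
    (Sum.elim (fun i => C (MvPolynomial.X (Sum.inr (Sum.inl i)))) fun _ => X))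

theorem graphSection_Y (k : ℕ) : graphSection k (Y k) = X := MvPolynomial.aeval_X _ _

theorem graphSection_pullback_U (k : ℕ) (i : Fin (k - 2)) :
    graphSection k (pullback k (MvPolynomial.X (Sum.inl i))) = C (MvPolynomial.X (Sum.inl i)) := by
  simp only [pullback, graphSection, MvPolynomial.aeval_X, Sum.elim_inl]

theorem graphSection_pullback_V (k : ℕ) (i : Fin (k - 1)) :
    graphSection k (pullback k (MvPolynomial.X (Sum.inr (Sum.inl i)))) =
      C (MvPolynomial.X (Sum.inr (Sum.inl i))) := by
  simp only [pullback, graphSection, MvPolynomial.aeval_X, Sum.elim_inl, Sum.elim_inr]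

theorem graphSection_pullback_W₁ (k : ℕ) : graphSection k (pullback k (W₁ k)) = polyU k := by
  simp only [pullback, W₁, MvPolynomial.aeval_X, Sum.elim_inr, Matrix.cons_val_zero, map_add,
    map_pow, map_sum, map_mul, graphSection_Y, polyU, finPoly_apply]
  simp only [graphSection, MvPolynomial.aeval_X, Sum.elim_inl]

theorem dvd_sub_graphSection_graphEval {k : ℕ} {s : Set (Tgt k)} {d : (TgtRing k)[X]}
    (h : ∀ t ∈ s, d ∣ C (MvPolynomial.X t) - graphSection k (pullback k (MvPolynomial.X t)))
    {p : (TgtRing k)[X]} (hp : p ∈ coeffsIn (MvPolynomial.supported ℝ s)) :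
    d ∣ p - graphSection k (graphEval k p) := by
  have hC (c : TgtRing k) (hc : c ∈ MvPolynomial.supported ℝ s) :
      d ∣ C c - graphSection k (pullback k c) :=
    dvd_map_sub_map_of_supported (f := CAlgHom) (g := (graphSection k).comp (pullback k)) h hc
  have heval := hom_eval₂ p (pullback k : TgtRing k →+* SrcRing k)
    (graphSection k : SrcRing k →+* (TgtRing k)[X]) (Y k)
  rw [RingHom.coe_coe, graphSection_Y] at heval
  rw [graphEval, coe_eval₂RingHom, heval]
  refine dvd_sub_eval₂_of_mem_coeffsIn (fun c hc => ?_) hp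
  exact hC c hc

/-- The target coordinates `U` and `V`, which are also coordinates of the source. -/
def parameters (k : ℕ) : Set (Tgt k) := {Sum.inr (Sum.inr 0), Sum.inr (Sum.inr 1)}ᶜ

theorem polyU_mem_coeffsIn (k : ℕ) :
    polyU k ∈ coeffsIn (MvPolynomial.supported ℝ (parameters k)) :=
  add_mem (pow_mem X_mem_coeffsIn k) <| finPoly_mem_coeffsIn fun _ =>
    MvPolynomial.X_mem_supported.2 (by simp [parameters])

theorem polyV_mem_coeffsIn (k : ℕ) :
    polyV k ∈ coeffsIn (MvPolynomial.supported ℝ (parameters k)) :=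
  finPoly_mem_coeffsIn fun _ => MvPolynomial.X_mem_supported.2 (by simp [parameters])

theorem graphSection_graphEval_of_parameters {k : ℕ} {p : (TgtRing k)[X]}
    (hp : p ∈ coeffsIn (MvPolynomial.supported ℝ (parameters k))) :
    graphSection k (graphEval k p) = p := by
  refine (sub_eq_zero.1 (zero_dvd_iff.1 (dvd_sub_graphSection_graphEval ?_ hp))).symm
  rintro (i | i | i) hi
  · rw [graphSection_pullback_U, sub_self]
  · rw [graphSection_pullback_V, sub_self]
  · fin_cases i <;> simp [parameters] at hi

theorem eq_zero_of_graphEval_eq_mul {k : ℕ} (hk : 2 ≤ k) {p : (TgtRing k)[X]}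
    (hp : p ∈ coeffsIn (MvPolynomial.supported ℝ (parameters k))) (hdeg : p.degree < (k - 1 : ℕ))
    {h : SrcRing k} (hh : graphEval k p = h * graphEval k (derivative (polyU k))) : p = 0 := by
  have hU' := derivative_mem_coeffsIn (polyU_mem_coeffsIn k)
  have hdvd : derivative (polyU k) ∣ p := by
    rw [← graphSection_graphEval_of_parameters hp, hh, map_mul,
      graphSection_graphEval_of_parameters hU']
    exact dvd_mul_left _ _
  refine eq_zero_of_dvd_of_degree_lt hdvd (hdeg.trans_eq ?_)
  rw [degree_derivative (by rw [natDegree_polyU hk]; omega), natDegree_polyU hk]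

theorem eq_zero_of_graphEval_eq_zero {k : ℕ} (hk : 2 ≤ k) {p : (TgtRing k)[X]}
    (hp : p ∈ coeffsIn (MvPolynomial.supported ℝ {Sum.inr (Sum.inr 1)}ᶜ)) (hdeg : p.degree < k)
    (h : graphEval k p = 0) : p = 0 := by
  have hdvd : polyU k - C (W₁ k) ∣ p - graphSection k (graphEval k p) := by
    refine dvd_sub_graphSection_graphEval ?_ hp
    rintro (i | i | i) hi
    · rw [graphSection_pullback_U, sub_self]
      exact dvd_zero _
    · rw [graphSection_pullback_V, sub_self]
      exact dvd_zero _
    · fin_cases i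
      · exact dvd_sub_comm.1 (graphSection_pullback_W₁ k ▸ dvd_rfl)
      · exact absurd rfl hi
  rw [h, map_zero, sub_zero] at hdvd
  refine eq_zero_of_dvd_of_degree_lt hdvd (hdeg.trans_eq ?_)
  rw [degree_sub_C (natDegree_pos_iff_degree_pos.1 (by rw [natDegree_polyU hk]; omega)),
    degree_eq_natDegree (monic_polyU hk).ne_zero, natDegree_polyU hk]

theorem xi_mem_generators {k j : ℕ} (hj : j ≠ 0) (hjk : j < k) :
    ({xi₁ k j, xi₂ k j, xi₃ k j} : Set (PolyField (Tgt k))) ⊆ generators k := by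
  have hIcc : (j : ℤ) ∈ Set.Icc (1 : ℤ) (k - 1) := Set.mem_Icc.2 (by omega)
  exact fun ξ hξ => Set.mem_union_right _ (Set.mem_biUnion hIcc hξ)

theorem xi₁_mem_span {k j : ℕ} (hj : j ≠ 0) (hjk : j < k) :
    xi₁ k j ∈ Submodule.span (TgtRing k) (generators k) :=
  Submodule.subset_span (xi_mem_generators hj hjk (by simp))

theorem xi₂_mem_span {k m : ℕ} (hm : m ≠ 0) (hmk : m < k) :
    xi₂ k (k - m) ∈ Submodule.span (TgtRing k) (generators k) := by
  rw [← Nat.cast_sub hmk.le]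
  exact Submodule.subset_span (xi_mem_generators (j := k - m) (by omega) (by omega) (by simp))

theorem xi₃_mem_span {k m : ℕ} (hm : m ≠ 0) (hmk : m < k) :
    xi₃ k (k - m) ∈ Submodule.span (TgtRing k) (generators k) := by
  rw [← Nat.cast_sub hmk.le]
  exact Submodule.subset_span (xi_mem_generators (j := k - m) (by omega) (by omega) (by simp))

theorem eulerField_mem_span (k : ℕ) :
    eulerField k ∈ Submodule.span (TgtRing k) (generators k) :=
  Submodule.subset_span (Set.mem_union_left _ rfl)

theorem smul_mem_reducible_symb₁ {k m : ℕ} (hk : 2 ≤ k) {ξ : PolyField (Tgt k)}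
    (hξ : ξ ∈ Submodule.span (TgtRing k) (generators k)) {κ w c : TgtRing k} {q : (TgtRing k)[X]}
    (hq : q ∈ coeffsIn (MvPolynomial.supported ℝ (parameters k)))
    (hκ : κ ∈ MvPolynomial.supported ℝ (parameters k))
    (hc : c ∈ MvPolynomial.supported ℝ (parameters k))
    (hm : m ≠ 0) (h : symb₁ k ξ = reducedMultiple (m + 1) κ w c q (polyU k)) :
    w • (C κ * (X * derivative (polyU k) /ₘ X ^ (m + 1))) ∈
      reducible (MvPolynomial.supported ℝ (parameters k)) (k - 1)
        ((Submodule.span (TgtRing k) (generators k)).map (symb₁ k)) := by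
  have hθ := (natDegree_X_mul_derivative_le (polyU k)).trans (natDegree_polyU hk).le
  refine mem_reducible_of_sub_mem (Submodule.mem_map_of_mem hξ) ?_ (degree_symb₁_lt hk ξ) ?_
  · refine (degree_smul_le _ _).trans_lt ((degree_le_of_natDegree_le
      ((natDegree_C_mul_le _ _).trans (natDegree_divByMonic_X_pow_le (m := k - 2) ?_))).trans_lt ?_)
    · omega
    · exact Nat.cast_lt.2 (by omega)
  · rw [smul_eq_C_mul, h]
    exact C_mul_sub_reducedMultiple_mem_coeffsIn (polyU_mem_coeffsIn k) hq hκ hc _ _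

theorem symb₁_mem_reducible {k : ℕ} (hk : 2 ≤ k) (ξ : PolyField (Tgt k)) :
    symb₁ k ξ ∈ reducible (MvPolynomial.supported ℝ (parameters k)) (k - 1)
      ((Submodule.span (TgtRing k) (generators k)).map (symb₁ k)) := by
  refine mem_reducible_supported_of_degree_lt (fun t ht a ha => ?_) (degree_symb₁_lt hk ξ)
  obtain ⟨m, hm, rfl⟩ : ∃ m, m ≠ 0 ∧ k = m + 1 + a := ⟨k - 1 - a, by omega, by omega⟩
  have hmk : m < m + 1 + a := by omega
  have hU := polyU_mem_coeffsIn (m + 1 + a)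
  have hV := polyV_mem_coeffsIn (m + 1 + a)
  have hθ := (natDegree_X_mul_derivative_le _).trans (natDegree_polyU hk).le
  refine ⟨C ((m + 1 + a : ℕ) : TgtRing (m + 1 + a)) *
      (X * derivative (polyU (m + 1 + a)) /ₘ X ^ (m + 1)),
    mul_mem (C_mem_coeffsIn (natCast_mem _ _))
      (divByMonic_X_pow_mem_coeffsIn (mul_mem X_mem_coeffsIn (derivative_mem_coeffsIn hU)) _),
    (natDegree_C_mul_le _ _).trans (natDegree_divByMonic_X_pow_le hθ),
    ⟨((m + 1 + a : ℕ) : ℝ) ^ 2, by positivity, ?_⟩, ?_⟩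
  · rw [coeff_C_mul, coeff_divByMonic_X_pow, coeff_X_mul_derivative, coeff_polyU_self, mul_one,
      ← sq, map_pow, map_natCast]
  · simp only [parameters, Set.mem_compl_iff, not_not] at ht
    obtain rfl | rfl := ht
    · exact smul_mem_reducible_symb₁ hk (xi₂_mem_span hm hmk) hU (natCast_mem _ _)
        (mul_mem (intCast_mem _ _) (coeff_polyU _ m ▸ hU m)) hm (symb₁_xi₂ hm hmk)
    · exact smul_mem_reducible_symb₁ hk (xi₃_mem_span hm hmk) hV (natCast_mem _ _)
        (mul_mem (natCast_mem _ _) (coeff_polyV _ m ▸ hV m)) hm (symb₁_xi₃ hm hmk)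

/-- The combination `k ξₑ - ξ²₁`, whose lift has vanishing `y`-component. -/
def eulerReduced (k : ℕ) : PolyField (Tgt k) := (k : TgtRing k) • eulerField k - xi₂ k 1

theorem xi₂_one_eq {k : ℕ} (hk : 2 ≤ k) : xi₂ k 1 = xi₂ k (k - (k - 1 : ℕ)) := by
  rw [Nat.cast_sub (by omega), Nat.cast_one, sub_sub_cancel]

theorem polyU_divByMonic_X_pow_self {k : ℕ} (hk : 2 ≤ k) : polyU k /ₘ X ^ k = 1 := by
  rw [eq_C_of_natDegree_le_zero (natDegree_divByMonic_X_pow_le (natDegree_polyU hk).le),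
    coeff_divByMonic_X_pow, add_zero, coeff_polyU_self, C_1]

theorem X_mul_derivative_polyU_divByMonic_X_pow_self {k : ℕ} (hk : 2 ≤ k) :
    X * derivative (polyU k) /ₘ X ^ k = C (k : TgtRing k) := by
  rw [eq_C_of_natDegree_le_zero (natDegree_divByMonic_X_pow_le
      ((natDegree_X_mul_derivative_le _).trans (natDegree_polyU hk).le)),
    coeff_divByMonic_X_pow, add_zero, coeff_X_mul_derivative, coeff_polyU_self, mul_one]

theorem X_mul_derivative_polyV_divByMonic_X_pow_self {k : ℕ} (hk : 2 ≤ k) :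
    X * derivative (polyV k) /ₘ X ^ k = 0 := by
  have hθ := (natDegree_X_mul_derivative_le _).trans (natDegree_polyV_le k)
  refine (divByMonic_eq_zero_iff (monic_X_pow k)).2 ?_
  rw [degree_X_pow]
  exact (degree_le_of_natDegree_le hθ).trans_lt (Nat.cast_lt.2 (by omega))

theorem symb₁_eulerReduced {k : ℕ} (hk : 2 ≤ k) : symb₁ k (eulerReduced k) = 0 := by
  rw [eulerReduced, map_sub, map_smul, xi₂_one_eq hk, symb₁_xi₂ (by omega) (by omega),
    reducedMultiple_eq, symb₁_eulerField hk, Nat.sub_add_cancel (by omega),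
    polyU_divByMonic_X_pow_self hk, X_mul_derivative_polyU_divByMonic_X_pow_self hk,
    ← coeff_polyU, coeff_polyU_pred hk, smul_eq_C_mul, mul_zero, C_0]
  ring

theorem symb₂_eulerReduced {k : ℕ} (hk : 2 ≤ k) :
    symb₂ k (eulerReduced k) = C ((k : TgtRing k) ^ 2) * (C (W₂ k) - polyV k) := by
  rw [eulerReduced, map_sub, map_smul, xi₂_one_eq hk, symb₂_xi₂ (by omega) (by omega),
    reducedMultiple_eq, symb₂_eulerField, Nat.sub_add_cancel (by omega),
    polyU_divByMonic_X_pow_self hk, X_mul_derivative_polyV_divByMonic_X_pow_self hk,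
    ← coeff_polyU, coeff_polyU_pred hk, smul_eq_C_mul]
  simp only [mul_zero, C_0, C_pow]
  ring

theorem eulerReduced_mem {k : ℕ} (hk : 2 ≤ k) :
    eulerReduced k ∈
      Submodule.span (TgtRing k) (generators k) ⊓ LinearMap.ker (symb₁ k) := by
  refine ⟨sub_mem (Submodule.smul_mem _ _ (eulerField_mem_span k)) ?_, symb₁_eulerReduced hk⟩
  rw [xi₂_one_eq hk]
  exact xi₂_mem_span (by omega) (by omega)

theorem xi₁Reduced_mem {k j : ℕ} (hj : j ≠ 0) (hjk : j < k) :
    xi₁Reduced k j ∈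
      Submodule.span (TgtRing k) (generators k) ⊓ LinearMap.ker (symb₁ k) :=
  ⟨sub_mem (xi₁_mem_span hj hjk) (Submodule.smul_mem _ _ (eulerField_mem_span k)),
    symb₁_xi₁Reduced k j⟩

theorem exists_symb₂_eq {k a : ℕ} (hk : 2 ≤ k) (ha : a < k) :
    ∃ b ∈ coeffsIn (MvPolynomial.supported ℝ (parameters k)), b.natDegree ≤ a ∧
      (∃ c : ℝ, c ≠ 0 ∧ b.coeff a = algebraMap ℝ (TgtRing k) c) ∧
      ∃ ξ ∈ Submodule.span (TgtRing k) (generators k) ⊓ LinearMap.ker (symb₁ k),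
        ∃ r ∈ coeffsIn (MvPolynomial.supported ℝ (parameters k)),
          symb₂ k ξ = b * (C (W₂ k) - polyV k) - r * (C (W₁ k) - polyU k) := by
  have hk₀ : (k : ℝ) ≠ 0 := Nat.cast_ne_zero.2 (by omega)
  have hκ := natCast_mem (MvPolynomial.supported ℝ (parameters k)) k
  obtain rfl | ha₀ := eq_or_ne a 0
  · refine ⟨C ((k : TgtRing k) ^ 2), C_mem_coeffsIn (pow_mem hκ 2), (natDegree_C _).le,
      ⟨(k : ℝ) ^ 2, pow_ne_zero 2 hk₀, ?_⟩, eulerReduced k, eulerReduced_mem hk, 0, zero_mem _, ?_⟩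
    · rw [coeff_C_zero, map_pow, map_natCast]
    · rw [symb₂_eulerReduced hk, zero_mul, sub_zero]
  obtain ⟨j, hj, hjk, hja⟩ : ∃ j, j ≠ 0 ∧ j < k ∧ k = j + a := ⟨k - a, by omega⟩
  have hU := polyU_mem_coeffsIn k
  have hUj : U k j ∈ MvPolynomial.supported ℝ (parameters k) := coeff_polyU k j ▸ hU j
  have hc : (j + k * (k - j) : TgtRing k) ∈ MvPolynomial.supported ℝ (parameters k) :=
    add_mem (natCast_mem _ j) (mul_mem hκ (sub_mem hκ (natCast_mem _ j)))
  refine ⟨C (k : TgtRing k) * (polyU k /ₘ X ^ j) - C ((j + k * (k - j) : TgtRing k) * U k j),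
    ?_, ?_, ⟨k, hk₀, ?_⟩, xi₁Reduced k j, xi₁Reduced_mem hj hjk,
    C (k : TgtRing k) * (polyV k /ₘ X ^ j), ?_, symb₂_xi₁Reduced hj hjk⟩
  · exact sub_mem (mul_mem (C_mem_coeffsIn hκ) (divByMonic_X_pow_mem_coeffsIn hU j))
      (C_mem_coeffsIn (mul_mem hc hUj))
  · exact (natDegree_sub_C).trans_le ((natDegree_C_mul_le _ _).trans
      (natDegree_divByMonic_X_pow_le ((natDegree_polyU hk).trans hja).le))
  · rw [coeff_sub, coeff_C_of_ne_zero ha₀, sub_zero, coeff_C_mul, coeff_divByMonic_X_pow, ← hja,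
      coeff_polyU_self, mul_one, map_natCast]
  · exact mul_mem (C_mem_coeffsIn hκ) (divByMonic_X_pow_mem_coeffsIn (polyV_mem_coeffsIn k) j)

theorem symb₂_mem_reducible {k : ℕ} (hk : 2 ≤ k) (ξ : PolyField (Tgt k)) :
    symb₂ k ξ ∈ reducible (MvPolynomial.supported ℝ {Sum.inr (Sum.inr 1)}ᶜ) k
      ((Submodule.span (TgtRing k) (generators k) ⊓ LinearMap.ker (symb₁ k)).map (symb₂ k)) := by
  refine mem_reducible_supported_of_degree_lt (fun t ht a ha => ?_) (degree_symb₂_lt hk ξ)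
  obtain rfl : t = Sum.inr (Sum.inr 1) := not_not.1 ht
  have hmono {p : (TgtRing k)[X]} (hp : p ∈ coeffsIn (MvPolynomial.supported ℝ (parameters k))) :
      p ∈ coeffsIn (MvPolynomial.supported ℝ ({Sum.inr (Sum.inr 1)}ᶜ : Set (Tgt k))) :=
    coeffsIn_mono (MvPolynomial.supported_mono (Set.compl_subset_compl.2 (by simp))) hp
  have hW₁ : W₁ k ∈ MvPolynomial.supported ℝ ({Sum.inr (Sum.inr 1)}ᶜ : Set (Tgt k)) :=
    MvPolynomial.X_mem_supported.2 (by simp)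
  obtain ⟨b, hb, hdeg, hlead, ζ, hζ, r, hr, hsymb⟩ := exists_symb₂_eq hk ha
  refine ⟨b, hmono hb, hdeg, hlead,
    mem_reducible_of_sub_mem (Submodule.mem_map_of_mem hζ) ?_ (degree_symb₂_lt hk ζ) ?_⟩
  · exact (degree_smul_le _ _).trans_lt
      ((degree_le_of_natDegree_le hdeg).trans_lt (Nat.cast_lt.2 ha))
  · have heq : (MvPolynomial.X (Sum.inr (Sum.inr 1)) : TgtRing k) • b - symb₂ k ζ =
        b * polyV k + r * (C (W₁ k) - polyU k) := by
      rw [smul_eq_C_mul, hsymb, W₂]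
      ring
    rw [heq]
    exact add_mem (mul_mem (hmono hb) (hmono (polyV_mem_coeffsIn k)))
      (mul_mem (hmono hr) (sub_mem (C_mem_coeffsIn hW₁) (hmono (polyU_mem_coeffsIn k))))

theorem exists_sub_mem_ker_symb₁ {k : ℕ} (hk : 2 ≤ k) {ξ : PolyField (Tgt k)}
    (hξ : ξ ∈ liftablePolyFields (crossCap k) (contDiff_crossCap k)) :
    ∃ ζ ∈ Submodule.span (TgtRing k) (generators k), symb₁ k (ξ - ζ) = 0 := by
  obtain ⟨_, ⟨ζ, hζ, rfl⟩, q, hq, hdeg, heq⟩ := mem_reducible.1 (symb₁_mem_reducible hk ξ)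
  refine ⟨ζ, hζ, ?_⟩
  obtain ⟨h, h₁, -⟩ := (mem_liftable_iff hk _).1 (sub_mem hξ (span_generators_le hk hζ))
  have hsymb : symb₁ k (ξ - ζ) = q := by rw [map_sub, ← heq, add_sub_cancel_left]
  rw [hsymb] at h₁ ⊢
  exact eq_zero_of_graphEval_eq_mul hk hq hdeg h₁

theorem mem_span_of_symb₁_eq_zero {k : ℕ} (hk : 2 ≤ k) {ξ : PolyField (Tgt k)}
    (hξ : ξ ∈ liftablePolyFields (crossCap k) (contDiff_crossCap k)) (h₀ : symb₁ k ξ = 0) :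
    ξ ∈ Submodule.span (TgtRing k) (generators k) := by
  obtain ⟨_, ⟨ζ, ⟨hζ, hζ₀⟩, rfl⟩, q, hq, hdeg, heq⟩ := mem_reducible.1 (symb₂_mem_reducible hk ξ)
  obtain ⟨h, h₁, h₂⟩ := (mem_liftable_iff hk _).1 (sub_mem hξ (span_generators_le hk hζ))
  have hsymb₁ : symb₁ k (ξ - ζ) = 0 := by rw [map_sub, h₀, LinearMap.mem_ker.1 hζ₀, sub_zero]
  have hsymb₂ : symb₂ k (ξ - ζ) = q := by rw [map_sub, ← heq, add_sub_cancel_left]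
  have hh : h = 0 := by
    rw [hsymb₁, map_zero] at h₁
    exact (mul_eq_zero.1 h₁.symm).resolve_right (graphEval_derivative_polyU_ne_zero hk)
  rw [hh, zero_mul, hsymb₂] at h₂
  have hq₀ : q = 0 := eq_zero_of_graphEval_eq_zero hk hq hdeg h₂
  rw [sub_eq_zero.1 (eq_zero_of_symb_eq_zero hsymb₁ (hsymb₂.trans hq₀))]
  exact hζ

theorem liftable_le_span {k : ℕ} (hk : 2 ≤ k) :
    liftablePolyFields (crossCap k) (contDiff_crossCap k) ≤
      Submodule.span (TgtRing k) (generators k) := fun ξ hξ => by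
  obtain ⟨ζ, hζ, h₀⟩ := exists_sub_mem_ker_symb₁ hk hξ
  exact (Submodule.sub_mem_iff_left _ hζ).1
    (mem_span_of_symb₁_eq_zero hk (sub_mem hξ (span_generators_le hk hζ)) h₀)

end CrossCap

end

theorem mainTheorem6 (k : ℕ) (hk : 2 ≤ k) :
    CrossCap.liftablePolyFields (CrossCap.crossCap k) (CrossCap.contDiff_crossCap k) =
      Submodule.span (MvPolynomial (CrossCap.Tgt k) ℝ) (CrossCap.generators k) :=
  le_antisymm (CrossCap.liftable_le_span hk) (CrossCap.span_generators_le hk)
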